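/- Let $G$ be a graph (simple, undirected, possibly infinite). Let $I^n$ be the graph on $\{0,1\}^n$ in which two vertices are adjacent iff they differ in exactly one coordinate. A graph map sends every edge to an edge or to a vertex; a singular $n$-cube in $G$ is a graph map $\sigma\colon I^n\to G$, and its image is the subgraph of $G$ consisting of the images of the vertices and those edges of $G$ that are images of edges. For $1\le i\le n$, $f_i^-\sigma$ and $f_i^+\sigma$ are the faces of $\sigma$ obtained by fixing the $i$-th coordinate to be $0$ and $1$. **Injective homology.** Let $C_n(G)$ be the free abelian group on the singular $n$-cubes modulo the degenerate ones (those with $f_i^-\sigma=f_i^+\sigma$ for some $i$), with boundary $\partial\sigma=\sum_{i=1}^n(-1)^i(f_i^-\sigma-f_i^+\sigma)$. The degree of $\sigma$ is the largest dimension of a face (of any dimension) of $I^n$ on which $\sigma$ is injective. Let $C^k_*(G)\subseteq C_*(G)$ be the subcomplex generated by the singular cubes of degree at most $k$ (zero for $k=-1$), let $C^{[k]}_*(G)=C^k_*(G)/C^{k-1}_*(G)$ and $H^{[k]}_*(G)=H_*(C^{[k]}_*(G))$. The spectral sequence of this filtration has $E^1_{p,q}=H^{[p]}_{p+q}(G)$,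 and $H^{inj}_*(G)$ is the homology of its edge complex $$H^{[0]}_0(G)\xleftarrow{d_1}H^{[1]}_1(G)\xleftarrow{d_1}H^{[2]}_2(G)\xleftarrow{d_1}\cdots .$$ **The complex $CW^\Box(G)$.** Let $CW^\Box(G)$ be the CW complex whose $n$-cells are the subgraphs $Q$ of $G$ isomorphic to $I^n$, with characteristic maps given by any choice of isomorphisms $\chi_Q\colon I^n\cong Q$. Its cellular chain group $C^{cell}_n$ is free abelian on the $n$-cells, and its boundary maps an $n$-cell $Q$ to $\sum_{i=1}^n(-1)^i\bigl([f_i^-\chi_Q]-[f_i^+\chi_Q]\bigr)$. Here an injective singular cube $\tau$ with image $Q'$ represents the chain $[\tau]=\det(\chi_{Q'}^{-1}\circ\tau)\,Q'$, where $\det=\pm1$ is the determinant of the linear part of the affine extension of this automorphism of the cube graph. $H_n(CW^\Box(G))$ is the homology of this complex. **Quasimonophobicity.** $G$ is $n$-quasimonophobic if every subgraph $Q$ of $G$ isomorphic to $I^n$ is an induced subgraph and, whenever a noninjective singular $(n+1)$-cube in $G$ has one of its $2(n+1)$ faces $f_i^{\pm}$ with image $Q$, at least one other of these faces also has image $Q$.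 **Theorem.** The homomorphisms $C^{cell}_n(CW^\Box(G))\to H^{[n]}_n(G)$, $n\ge 0$, that send a cell $Q$ to the class of $\chi_Q$ form a chain map from the cellular chain complex of $CW^\Box(G)$ to the edge complex, and hence induce natural maps $$H_n(CW^\Box(G))\to H^{inj}_n(G).$$ If $G$ is $n$-quasimonophobic, then this map is injective. If in addition $n=0$ or $G$ is $(n-1)$-quasimonophobic, then it is an isomorphism. -/

import Mathlib

universe u

namespace DiscreteCubical

open CategoryTheory

/-- The discrete `n`-cube graph `I^n`: vertices `{0,1}^n` (`false` is `0`, `true` is `1`), two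
vertices being adjacent iff they differ in exactly one coordinate. -/
def cube (n : ℕ) : SimpleGraph (Fin n → Bool) where
  Adj x y := hammingDist x y = 1
  symm := ⟨fun x y h => by rwa [hammingDist_comm]⟩
  loopless := ⟨fun x h => by simp at h⟩

/-- A singular `n`-cube in `G`: a graph map `I^n → G`, i.e. a map of vertices sending every edge to
an edge or to a vertex. -/
@[ext]
structure SingularCube {V : Type u} (G : SimpleGraph V) (n : ℕ) where
  toFun : (Fin n → Bool) → V
  map_adj : ∀ x y, (cube n).Adj x y → G.Adj (toFun x) (toFun y) ∨ toFun x = toFun y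

variable {V : Type u} {G : SimpleGraph V}

theorem hammingDist_insertNth {n : ℕ} (i : Fin (n + 1)) (a b : Bool) (x y : Fin n → Bool) :
    hammingDist (i.insertNth a x : Fin (n + 1) → Bool) (i.insertNth b y) =
      (if a = b then 0 else 1) + hammingDist x y := by
  simp only [hammingDist, Finset.card_filter]
  rw [Fin.sum_univ_succAbove _ i]
  simp

/-- The face of a singular cube obtained by fixing the `i`-th coordinate: the front face for
`a = false` (coordinate equal to `0`), the back face for `a = true` (coordinate equal to `1`). -/
def SingularCube.face {n : ℕ} (i : Fin (n + 1)) (a : Bool) (σ : SingularCube G (n + 1)) :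
    SingularCube G n where
  toFun t := σ.toFun (i.insertNth a t)
  map_adj x y h := σ.map_adj _ _ (by
    change hammingDist _ _ = 1
    rw [hammingDist_insertNth, if_pos rfl, zero_add]; exact h)

/-- The image of a singular cube: the subgraph of `G` whose vertices are the images of the vertices
of `I^n` and whose edges are those edges of `G` that are images of edges of `I^n`. -/
def SingularCube.image {n : ℕ} (σ : SingularCube G n) : G.Subgraph where
  verts := Set.range σ.toFun
  Adj v w := G.Adj v w ∧ ∃ x y, (cube n).Adj x y ∧ σ.toFun x = v ∧ σ.toFun y = w
  adj_sub h := h.1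
  edge_vert := by rintro v w ⟨_, x, y, _, rfl, _⟩; exact ⟨x, rfl⟩
  symm := ⟨by rintro v w ⟨h, x, y, hxy, hx, hy⟩; exact ⟨h.symm, y, x, hxy.symm, hy, hx⟩⟩

/-- The subgraph `Q` is an `n`-cube, i.e. it is isomorphic to `I^n`. -/
def IsCube (n : ℕ) (Q : G.Subgraph) : Prop := Nonempty (cube n ≃g Q.coe)

/-- `G` is `n`-quasimonophobic: every `n`-cube `Q` in `G` is rigid (an induced subgraph), and
whenever a noninjective singular `(n+1)`-cube has a face supported by `Q` (a face with image `Q`),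
at least one more of its `2(n+1)` faces is supported by `Q`. -/
def IsQuasimonophobic (G : SimpleGraph V) (n : ℕ) : Prop :=
  ∀ Q : G.Subgraph, IsCube n Q → Q.IsInduced ∧
    ∀ τ : SingularCube G (n + 1), ¬ Function.Injective τ.toFun →
      ∀ (i : Fin (n + 1)) (a : Bool), (τ.face i a).image = Q →
        ∃ (j : Fin (n + 1)) (b : Bool), (j, b) ≠ (i, a) ∧ (τ.face j b).image = Q

/-! ### Normalized singular cubical chains -/

/-- The boundary `∂ : Q_{n+1}(G) → Q_n(G)`, `∂σ = ∑ᵢ (-1)^i (f_i^- σ - f_i^+ σ)`, on the free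
abelian groups on singular cubes. (The `i`-th coordinate, `1 ≤ i ≤ n + 1`, is the element `i - 1`
of `Fin (n + 1)`.) -/
noncomputable def bdQ (G : SimpleGraph V) (n : ℕ) :
    (SingularCube G (n + 1) →₀ ℤ) →ₗ[ℤ] (SingularCube G n →₀ ℤ) :=
  Finsupp.linearCombination ℤ fun σ => ∑ i : Fin (n + 1), (-1 : ℤ) ^ ((i : ℕ) + 1) •
    (Finsupp.single (σ.face i false) (1 : ℤ) - Finsupp.single (σ.face i true) 1)

theorem bdQ_single (n : ℕ) (σ : SingularCube G (n + 1)) :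
    bdQ G n (Finsupp.single σ 1) = ∑ i : Fin (n + 1), (-1 : ℤ) ^ ((i : ℕ) + 1) •
      (Finsupp.single (σ.face i false) (1 : ℤ) - Finsupp.single (σ.face i true) 1) := by
  rw [bdQ, Finsupp.linearCombination_single, one_smul]

theorem insertNth_insertNth {n : ℕ} (j : Fin (n + 2)) (i : Fin (n + 1)) (b a : Bool)
    (t : Fin n → Bool) :
    (j.insertNth b (i.insertNth a t : Fin (n + 1) → Bool) : Fin (n + 2) → Bool) =
      (j.succAbove i).insertNth a ((i.predAbove j).insertNth b t : Fin (n + 1) → Bool) := by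
  rw [Fin.eq_insertNth_iff, Fin.eq_insertNth_iff]
  refine ⟨by simp, ?_, ?_⟩
  · simp only [Fin.removeNth, Fin.succAbove_succAbove_predAbove, Fin.insertNth_apply_same]
  · rw [← Fin.removeNth_removeNth_eq_swap]
    simp

theorem face_face {n : ℕ} (j : Fin (n + 2)) (i : Fin (n + 1)) (b a : Bool)
    (σ : SingularCube G (n + 2)) :
    (σ.face j b).face i a = (σ.face (j.succAbove i) a).face (i.predAbove j) b := by
  ext t
  simp only [SingularCube.face]
  rw [insertNth_insertNth]

/-- An alternating double sum over the codimension two faces vanishes. -/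
theorem sum_faces_eq_zero {A : Type*} [AddCommGroup A] {n : ℕ}
    (F : Fin (n + 2) → Bool → Fin (n + 1) → Bool → A)
    (hF : ∀ j b i a, F j b i a = F (j.succAbove i) a (i.predAbove j) b) :
    ∑ j : Fin (n + 2), (-1 : ℤ) ^ ((j : ℕ) + 1) •
      ((∑ i : Fin (n + 1), (-1 : ℤ) ^ ((i : ℕ) + 1) • (F j false i false - F j false i true)) -
        ∑ i : Fin (n + 1), (-1 : ℤ) ^ ((i : ℕ) + 1) • (F j true i false - F j true i true)) = 0 := by
  have h : ∀ j : Fin (n + 2), (-1 : ℤ) ^ ((j : ℕ) + 1) •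
      ((∑ i : Fin (n + 1), (-1 : ℤ) ^ ((i : ℕ) + 1) • (F j false i false - F j false i true)) -
        ∑ i : Fin (n + 1), (-1 : ℤ) ^ ((i : ℕ) + 1) • (F j true i false - F j true i true)) =
      ∑ i : Fin (n + 1), (-1 : ℤ) ^ ((j : ℕ) + (i : ℕ)) •
        (F j false i false - F j false i true - (F j true i false - F j true i true)) := by
    intro j
    rw [← Finset.sum_sub_distrib, Finset.smul_sum]
    refine Finset.sum_congr rfl fun i _ => ?_
    rw [← smul_sub, smul_smul]
    congr 1
    ring
  simp_rw [h]
  rw [← Finset.sum_product']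
  refine Finset.sum_involution (fun p _ => (p.1.succAbove p.2, p.2.predAbove p.1)) ?_ ?_ ?_ ?_
  · rintro ⟨j, i⟩ -
    simp only [Fin.neg_one_pow_succAbove_add_predAbove]
    rw [hF j false i false, hF j false i true, hF j true i false, hF j true i true, neg_smul,
      ← sub_eq_add_neg, ← smul_sub]
    refine (congrArg _ ?_).trans (smul_zero _)
    abel
  · rintro ⟨j, i⟩ - - h
    exact Fin.succAbove_ne _ _ (congrArg Prod.fst h)
  · simp
  · rintro ⟨j, i⟩ -
    simp [Fin.succAbove_succAbove_predAbove, Fin.predAbove_predAbove_succAbove]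

theorem bdQ_bdQ (n : ℕ) : bdQ G n ∘ₗ bdQ G (n + 1) = 0 := by
  refine Finsupp.lhom_ext' fun σ => LinearMap.ext_ring ?_
  simp only [LinearMap.comp_apply, Finsupp.lsingle_apply, LinearMap.zero_apply]
  rw [bdQ_single, map_sum]
  simp only [map_smul, map_sub, bdQ_single]
  exact sum_faces_eq_zero
    (fun j b i a => Finsupp.single ((σ.face j b).face i a) (1 : ℤ))
    (fun j b i a => by rw [face_face])

/-- A singular cube is degenerate if for some `i` its front and back `i`-faces agree. -/
def IsDegenerate : {n : ℕ} → SingularCube G n → Prop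
  | 0, _ => False
  | _ + 1, σ => ∃ i, σ.face i false = σ.face i true

/-- The subgroup of `Q_n(G)` generated by the degenerate singular cubes. -/
noncomputable def degenerate (G : SimpleGraph V) (n : ℕ) : Submodule ℤ (SingularCube G n →₀ ℤ) :=
  Submodule.span ℤ ((fun σ => Finsupp.single σ 1) '' {σ | IsDegenerate σ})

theorem bdQ_degenerate (n : ℕ) : degenerate G (n + 1) ≤ (degenerate G n).comap (bdQ G n) := by
  rw [degenerate, Submodule.span_le]
  rintro _ ⟨σ, ⟨i, hi⟩, rfl⟩
  change bdQ G n (Finsupp.single σ 1) ∈ degenerate G n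
  rw [bdQ_single]
  refine (degenerate G n).sum_mem fun j _ => (degenerate G n).smul_mem _ ?_
  rcases eq_or_ne j i with rfl | hj
  · rw [hi, sub_self]; exact Submodule.zero_mem _
  · have key : ∀ b, Finsupp.single (σ.face j b) (1 : ℤ) ∈ degenerate G n := by
      intro b
      refine Submodule.subset_span ⟨_, ?_, rfl⟩
      obtain ⟨k, rfl⟩ := Fin.exists_succAbove_eq hj.symm
      obtain ⟨m, rfl⟩ : ∃ m, n = m + 1 := ⟨n - 1, by have := k.pos; omega⟩
      exact ⟨k, by rw [face_face j k b false, face_face j k b true, hi]⟩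
    exact Submodule.sub_mem _ (key _) (key _)

/-- The normalized singular cubical chains `C_n(G) = Q_n(G) / D_n(G)`. -/
abbrev Chains (G : SimpleGraph V) (n : ℕ) : Type u :=
  (SingularCube G n →₀ ℤ) ⧸ degenerate G n

/-- The class in `C_n(G)` of a singular `n`-cube. -/
noncomputable def chainOf {n : ℕ} (σ : SingularCube G n) : Chains G n :=
  (degenerate G n).mkQ (Finsupp.single σ 1)

/-- The boundary `∂ : C_{n+1}(G) → C_n(G)`. -/
noncomputable def bd (G : SimpleGraph V) (n : ℕ) : Chains G (n + 1) →ₗ[ℤ] Chains G n :=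
  (degenerate G (n + 1)).mapQ (degenerate G n) (bdQ G n) (bdQ_degenerate n)

theorem bd_chainOf (n : ℕ) (σ : SingularCube G (n + 1)) :
    bd G n (chainOf σ) = ∑ i : Fin (n + 1), (-1 : ℤ) ^ ((i : ℕ) + 1) •
      (chainOf (σ.face i false) - chainOf (σ.face i true)) := by
  simp only [bd, chainOf, Submodule.mkQ_apply, Submodule.mapQ_apply, bdQ_single]
  simp only [← Submodule.mkQ_apply, map_sum, map_smul, map_sub]

theorem bd_bd (n : ℕ) (x : Chains G (n + 2)) : bd G n (bd G (n + 1) x) = 0 := by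
  obtain ⟨y, rfl⟩ := Submodule.mkQ_surjective _ x
  simp only [bd, Submodule.mkQ_apply, Submodule.mapQ_apply]
  rw [← LinearMap.comp_apply, bdQ_bdQ]
  simp

/-! ### The degree filtration -/

/-- The degree of a singular cube `σ`: the maximal dimension of a face of `I^n` on which `σ` is
injective. A face of `I^n` of dimension `S.card` is given by the set `S` of its free coordinates and
the values `c i` of the other coordinates. -/
noncomputable def degree {n : ℕ} (σ : SingularCube G n) : ℕ :=
  sSup {k | ∃ (S : Finset (Fin n)) (c : Fin n → Bool), S.card = k ∧
    Set.InjOn σ.toFun {t | ∀ i, i ∉ S → t i = c i}}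

theorem degree_bddAbove {n : ℕ} (σ : SingularCube G n) :
    n ∈ upperBounds {k | ∃ (S : Finset (Fin n)) (c : Fin n → Bool), S.card = k ∧
      Set.InjOn σ.toFun {t | ∀ i, i ∉ S → t i = c i}} := by
  rintro k ⟨S, c, rfl, -⟩
  simpa using S.card_le_univ

theorem degree_le {n : ℕ} (σ : SingularCube G n) : degree σ ≤ n :=
  csSup_le' (degree_bddAbove σ)

theorem degree_face_le {n : ℕ} (i : Fin (n + 1)) (a : Bool) (σ : SingularCube G (n + 1)) :
    degree (σ.face i a) ≤ degree σ := by
  refine csSup_le' ?_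
  rintro k ⟨S, c, rfl, h⟩
  refine le_csSup ⟨_, degree_bddAbove σ⟩
    ⟨S.map i.succAboveEmb, i.insertNth a c, by simp, ?_⟩
  have key : ∀ t : Fin (n + 1) → Bool,
      (∀ j, j ∉ S.map i.succAboveEmb → t j = (i.insertNth a c : Fin (n + 1) → Bool) j) →
      t = i.insertNth a (i.removeNth t) ∧ ∀ j, j ∉ S → i.removeNth t j = c j := by
    intro t ht
    refine ⟨?_, fun j hj => ?_⟩
    · rw [Fin.eq_insertNth_iff]
      refine ⟨?_, rfl⟩
      simpa using ht i (by simp [Fin.succAbove_ne])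
    · simpa [Fin.removeNth] using ht (i.succAbove j) (by simpa using hj)
  intro x hx y hy hxy
  obtain ⟨hx1, hx2⟩ := key x hx
  obtain ⟨hy1, hy2⟩ := key y hy
  rw [hx1, hy1] at hxy ⊢
  rw [h hx2 hy2 hxy]

/-- The subgroup of `C_n(G)` generated by the singular `n`-cubes of degree `< k`. Thus the term
`C_n^k(G)` of the degree filtration (degree `k` or below) is `fil G (k + 1) n`, and `fil G k n` is
`C_n^{k-1}(G)`, also for `k = 0`, where it is zero. -/
noncomputable def fil (G : SimpleGraph V) (k n : ℕ) : Submodule ℤ (Chains G n) :=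
  Submodule.span ℤ (chainOf '' {σ | degree σ < k})

theorem fil_mono (k n : ℕ) : fil G k n ≤ fil G (k + 1) n :=
  Submodule.span_mono (Set.image_mono fun _ h => Nat.lt_succ_of_lt h)

theorem fil_eq_top {k n : ℕ} (h : n < k) : fil G k n = ⊤ := by
  rw [eq_top_iff]
  rintro x -
  obtain ⟨y, rfl⟩ := Submodule.mkQ_surjective _ x
  induction y using Finsupp.induction_linear with
  | zero => simp
  | add a b ha hb => rw [map_add]; exact Submodule.add_mem _ ha hb
  | single σ m =>
    rw [← mul_one m, ← smul_eq_mul, ← Finsupp.smul_single, map_smul]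
    exact Submodule.smul_mem _ _ (Submodule.subset_span ⟨σ, (degree_le σ).trans_lt h, rfl⟩)

theorem bd_fil (k n : ℕ) : ∀ x ∈ fil G k (n + 1), bd G n x ∈ fil G k n := by
  suffices h : fil G k (n + 1) ≤ (fil G k n).comap (bd G n) from fun x hx => h hx
  rw [fil, Submodule.span_le]
  rintro _ ⟨σ, hσ, rfl⟩
  change bd G n (chainOf σ) ∈ fil G k n
  rw [bd_chainOf]
  have key : ∀ i a, chainOf (σ.face i a) ∈ fil G k n := fun i a =>
    Submodule.subset_span ⟨_, (degree_face_le i a σ).trans_lt hσ, rfl⟩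
  exact (fil G k n).sum_mem fun j _ =>
    (fil G k n).smul_mem _ ((fil G k n).sub_mem (key _ _) (key _ _))

/-- The differential on `fil G k`. -/
noncomputable def bdFil (G : SimpleGraph V) (k n : ℕ) : fil G k (n + 1) →ₗ[ℤ] fil G k n :=
  (bd G n).restrict (bd_fil k n)

/-- The chain complex `fil G k`, with `fil G (k + 1)` equal to `C^k_*(G)`. -/
noncomputable def filComplex (G : SimpleGraph V) (k : ℕ) : ChainComplex (ModuleCat.{u} ℤ) ℕ :=
  ChainComplex.of (fun n => ModuleCat.of ℤ (fil G k n)) (fun n => ModuleCat.ofHom (bdFil G k n))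
    (fun n => by
      rw [← ModuleCat.ofHom_comp]
      exact congrArg ModuleCat.ofHom (LinearMap.ext fun x => Subtype.ext (bd_bd n x.1)))

/-- The associated graded `C_n^{[k]}(G) = C_n^k(G) / C_n^{k-1}(G)`. -/
abbrev Gr (G : SimpleGraph V) (k n : ℕ) : Type u :=
  fil G (k + 1) n ⧸ (fil G k n).submoduleOf (fil G (k + 1) n)

/-- The differential on `C^{[k]}_*(G)`. -/
noncomputable def bdGr (G : SimpleGraph V) (k n : ℕ) : Gr G k (n + 1) →ₗ[ℤ] Gr G k n :=
  Submodule.mapQ _ _ (bdFil G (k + 1) n) fun x hx => bd_fil k n x.1 hx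

/-- The complex `C^{[k]}_*(G)`, the `k`-th associated graded complex of the degree filtration. Its
homology groups are the groups `H^{[k]}_*(G)`. -/
noncomputable def grComplex (G : SimpleGraph V) (k : ℕ) : ChainComplex (ModuleCat.{u} ℤ) ℕ :=
  ChainComplex.of (fun n => ModuleCat.of ℤ (Gr G k n)) (fun n => ModuleCat.ofHom (bdGr G k n))
    (fun n => by
      rw [← ModuleCat.ofHom_comp]
      refine congrArg ModuleCat.ofHom (LinearMap.ext fun x => ?_)
      obtain ⟨y, rfl⟩ := Submodule.mkQ_surjective _ x
      change (Submodule.mkQ _) (bdFil G (k + 1) n (bdFil G (k + 1) (n + 1) y)) = 0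
      have : bdFil G (k + 1) n (bdFil G (k + 1) (n + 1) y) = 0 := Subtype.ext (bd_bd n y.1)
      rw [this, map_zero])

/-- The inclusion `C^{k-1}_*(G) → C^k_*(G)`. -/
noncomputable def filIncl (G : SimpleGraph V) (k : ℕ) : filComplex G k ⟶ filComplex G (k + 1) :=
  ChainComplex.ofHom (fun n => ModuleCat.ofHom (Submodule.inclusion (fil_mono k n)))
    (fun n => by
      simp only [filComplex, ChainComplex.of_d]
      rfl)

/-- The projection `C^k_*(G) → C^{[k]}_*(G)`. -/
noncomputable def filProj (G : SimpleGraph V) (k : ℕ) : filComplex G (k + 1) ⟶ grComplex G k :=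
  ChainComplex.ofHom
    (fun n => ModuleCat.ofHom ((fil G k n).submoduleOf (fil G (k + 1) n)).mkQ)
    (fun n => by
      simp only [filComplex, grComplex, ChainComplex.of_d]
      rfl)

/-- The sequence of complexes `0 → C^{k-1}_*(G) → C^k_*(G) → C^{[k]}_*(G) → 0`. -/
noncomputable def filSeq (G : SimpleGraph V) (k : ℕ) :
    ShortComplex (ChainComplex (ModuleCat.{u} ℤ) ℕ) :=
  ShortComplex.mk (filIncl G k) (filProj G k) (by
    ext n x
    change (Submodule.mkQ _) (Submodule.inclusion (fil_mono k n) x) = 0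
    rw [Submodule.mkQ_apply, Submodule.Quotient.mk_eq_zero]
    exact x.2)

theorem filSeq_shortExact (G : SimpleGraph V) (k : ℕ) : (filSeq G k).ShortExact := by
  refine HomologicalComplex.shortExact_of_degreewise_shortExact _ fun n => ?_
  refine ShortComplex.ShortExact.mk' ?_ ?_ ?_
  · rw [ShortComplex.ShortExact.moduleCat_exact_iff_function_exact]
    intro (x : fil G (k + 1) n)
    refine (Submodule.Quotient.mk_eq_zero ((fil G k n).submoduleOf (fil G (k + 1) n))).trans ?_
    constructor
    · intro hx
      exact ⟨⟨x.1, hx⟩, rfl⟩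
    · rintro ⟨y, rfl⟩
      exact y.2
  · rw [ModuleCat.mono_iff_injective]
    exact Submodule.inclusion_injective (fil_mono k n)
  · rw [ModuleCat.epi_iff_surjective]
    exact Submodule.mkQ_surjective _

/-! ### Injective homology -/

/-- The connecting homomorphism `H^{[k+1]}_{k+1}(G) → H_k(C^k_*(G))` of the short exact sequence
`0 → C^k_*(G) → C^{k+1}_*(G) → C^{[k+1]}_*(G) → 0`. -/
noncomputable def edgeConn (G : SimpleGraph V) (k : ℕ) :
    (grComplex G (k + 1)).homology (k + 1) ⟶ (filComplex G (k + 1)).homology k :=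
  (filSeq_shortExact G (k + 1)).δ (k + 1) k (ComplexShape.down_mk (k + 1) k rfl)

theorem filProj_edgeConn (G : SimpleGraph V) (k : ℕ) :
    HomologicalComplex.homologyMap (filProj G (k + 1)) (k + 1) ≫ edgeConn G k = 0 :=
  (filSeq_shortExact G (k + 1)).comp_δ (k + 1) k (ComplexShape.down_mk (k + 1) k rfl)

/-- The differential `d_1 : H^{[k+1]}_{k+1}(G) → H^{[k]}_k(G)` on the edge of the `E^1`-page of the
degree spectral sequence, from the exact couple of the filtration: the connecting homomorphism
`H_{k+1}(C^{[k+1]}_*(G)) → H_k(C^k_*(G))` followed by the projection to `H_k(C^{[k]}_*(G))`. -/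
noncomputable def edgeD (G : SimpleGraph V) (k : ℕ) :
    (grComplex G (k + 1)).homology (k + 1) ⟶ (grComplex G k).homology k :=
  edgeConn G k ≫ HomologicalComplex.homologyMap (filProj G k) k

/-- The edge complex `H^{[0]}_0(G) ← H^{[1]}_1(G) ← H^{[2]}_2(G) ← ⋯` with differential `d_1`. Its
homology groups are the injective homology groups `H^{inj}_*(G)`. -/
noncomputable def edgeComplex (G : SimpleGraph V) : ChainComplex (ModuleCat.{u} ℤ) ℕ :=
  ChainComplex.of (fun k => (grComplex G k).homology k) (edgeD G) (fun k => by
    unfold edgeD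
    rw [Category.assoc, reassoc_of% (filProj_edgeConn G k), Limits.zero_comp, Limits.comp_zero])

theorem grComplex_d_eq_zero (G : SimpleGraph V) (n j : ℕ) : (grComplex G n).d n j = 0 := by
  by_cases h : j + 1 = n
  · subst h
    have : Subsingleton (Gr G (j + 1) j) := by
      rw [Submodule.Quotient.subsingleton_iff, Submodule.submoduleOf,
        fil_eq_top (Nat.lt_succ_self j), Submodule.comap_top]
    refine ModuleCat.hom_ext (LinearMap.ext fun x => ?_)
    exact this.elim _ _
  · exact (grComplex G n).shape n j h

/-- The projection of `C^{[n]}_n(G)`, which consists of cycles since `C^{[n]}_{n-1}(G) = 0`, onto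
`H^{[n]}_n(G)`. -/
noncomputable def grToHomology (G : SimpleGraph V) (n : ℕ) :
    (grComplex G n).X n ⟶ (grComplex G n).homology n :=
  (grComplex G n).liftCycles (𝟙 _) _ rfl
    (by rw [grComplex_d_eq_zero, Limits.comp_zero]) ≫ (grComplex G n).homologyπ n

/-- The class in `C^{[n]}_n(G)` of a singular `n`-cube. -/
noncomputable def grOf {n : ℕ} (σ : SingularCube G n) : Gr G n n :=
  Submodule.Quotient.mk
    ⟨chainOf σ, Submodule.subset_span ⟨σ, Nat.lt_succ_of_le (degree_le σ), rfl⟩⟩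

/-- The class in `H^{[n]}_n(G)` of a singular `n`-cube. -/
noncomputable def edgeClass {n : ℕ} (σ : SingularCube G n) : (grComplex G n).homology n :=
  (grToHomology G n).hom (grOf σ)

/-! ### The cellular chain complex of `CW^□(G)` -/

/-- The `n`-cells of `CW^□(G)`: the subgraphs of `G` isomorphic to `I^n`. -/
def Cell (G : SimpleGraph V) (n : ℕ) : Type u := {Q : G.Subgraph // IsCube n Q}

/-- A choice of characteristic maps for the cells of `CW^□(G)`: for every `n`-cell `Q` an
isomorphism `I^n ≅ Q`, inducing the map from the solid `n`-cube onto the closed cell. -/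
abbrev CharMaps (G : SimpleGraph V) : Type u :=
  ∀ (n : ℕ) (Q : Cell G n), cube n ≃g Q.1.coe

/-- The characteristic map of a cell, as a singular cube in `G`. -/
def CharMaps.chart (χ : CharMaps G) {n : ℕ} (Q : Cell G n) : SingularCube G n where
  toFun t := (χ n Q t).1
  map_adj _ _ h := Or.inl (Q.1.adj_sub ((χ n Q).map_rel_iff.2 h))

theorem CharMaps.chart_injective (χ : CharMaps G) {n : ℕ} (Q : Cell G n) :
    Function.Injective (χ.chart Q).toFun :=
  Subtype.val_injective.comp (χ n Q).injective

theorem CharMaps.image_chart (χ : CharMaps G) {n : ℕ} (Q : Cell G n) :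
    (χ.chart Q).image = Q.1 := by
  refine SimpleGraph.Subgraph.ext ?_ ?_
  · ext v
    constructor
    · rintro ⟨t, rfl⟩
      exact (χ n Q t).2
    · intro hv
      obtain ⟨t, ht⟩ := (χ n Q).surjective ⟨v, hv⟩
      exact ⟨t, congrArg Subtype.val ht⟩
  · ext v w
    constructor
    · rintro ⟨-, x, y, hxy, rfl, rfl⟩
      exact (χ n Q).map_rel_iff.2 hxy
    · intro h
      obtain ⟨x, hx⟩ := (χ n Q).surjective ⟨v, Q.1.edge_vert h⟩
      obtain ⟨y, hy⟩ := (χ n Q).surjective ⟨w, Q.1.edge_vert h.symm⟩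
      refine ⟨Q.1.adj_sub h, x, y, (χ n Q).map_rel_iff.1 ?_, congrArg Subtype.val hx,
        congrArg Subtype.val hy⟩
      rw [hx, hy]
      exact h

/-- An injective singular cube is an isomorphism onto its image. -/
theorem SingularCube.isCube_image {n : ℕ} (σ : SingularCube G n)
    (h : Function.Injective σ.toFun) : IsCube n σ.image :=
  ⟨{ toEquiv := Equiv.ofInjective σ.toFun h
     map_rel_iff' := by
      intro x y
      constructor
      · rintro ⟨-, x', y', hxy, hx, hy⟩
        rwa [← h hx, ← h hy]
      · intro hxy
        refine ⟨(σ.map_adj x y hxy).resolve_right fun e => hxy.ne (h e), x, y, hxy, rfl, rfl⟩ }⟩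

/-- The cell given by the image of an injective singular cube. -/
def SingularCube.cell {n : ℕ} (σ : SingularCube G n) (h : Function.Injective σ.toFun) : Cell G n :=
  ⟨σ.image, σ.isCube_image h⟩

/-- The vertices `0`, `1` of the unit interval as integers. -/
def bit (b : Bool) : ℤ := if b then 1 else 0

/-- For an automorphism `g` of the graph `I^n`, the integer matrix of the linear part of the affine
map `ℝ^n → ℝ^n` that extends `g`: its `j`-th column is `g(e_j) - g(0)`. -/
def linearPart {n : ℕ} (g : (Fin n → Bool) → (Fin n → Bool)) : Matrix (Fin n) (Fin n) ℤ :=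
  Matrix.of fun i j =>
    bit (g (Function.update (fun _ => false) j true) i) - bit (g (fun _ => false) i)

/-- The sign of an injective singular `n`-cube `σ` with image the cell `Q`, relative to the
characteristic map `χ_Q`: the degree of the affine automorphism `χ_Q⁻¹ ∘ σ` of the solid cube, i.e.
the determinant of its linear part. -/
noncomputable def CharMaps.sign (χ : CharMaps G) {n : ℕ} (σ : SingularCube G n)
    (h : Function.Injective σ.toFun) : ℤ :=
  (linearPart fun t => Function.invFun (χ.chart (σ.cell h)).toFun (σ.toFun t)).det

/-- The cellular chain represented by an injective singular cube: the cell that is its image, with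
the sign comparing it with the characteristic map of that cell. -/
noncomputable def CharMaps.cellChain (χ : CharMaps G) {n : ℕ} (σ : SingularCube G n)
    (h : Function.Injective σ.toFun) : Cell G n →₀ ℤ :=
  Finsupp.single (σ.cell h) (χ.sign σ h)

theorem SingularCube.face_injective {n : ℕ} {σ : SingularCube G (n + 1)}
    (h : Function.Injective σ.toFun) (i : Fin (n + 1)) (a : Bool) :
    Function.Injective (σ.face i a).toFun :=
  h.comp (Fin.insertNth_right_injective (α := fun _ => Bool) (p := i) a)

/-- The cellular chain of the boundary of an injective singular cube. -/
noncomputable def CharMaps.bdChain (χ : CharMaps G) {n : ℕ} (σ : SingularCube G (n + 1))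
    (h : Function.Injective σ.toFun) : Cell G n →₀ ℤ :=
  ∑ i : Fin (n + 1), (-1 : ℤ) ^ ((i : ℕ) + 1) •
    (χ.cellChain (σ.face i false) (SingularCube.face_injective h i false) -
      χ.cellChain (σ.face i true) (SingularCube.face_injective h i true))

/-- The cellular boundary: `Q` is mapped to `∑ᵢ (-1)^i (f_i^- χ_Q - f_i^+ χ_Q)`, where each face of
the characteristic map `χ_Q` is counted as the cell that is its image, with the degree of the
attaching map on this face. -/
noncomputable def CharMaps.cellBd (χ : CharMaps G) (n : ℕ) :
    (Cell G (n + 1) →₀ ℤ) →ₗ[ℤ] (Cell G n →₀ ℤ) :=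
  Finsupp.linearCombination ℤ fun Q => χ.bdChain (χ.chart Q) (χ.chart_injective Q)

/-! The square of the cellular boundary is zero. -/

/-- Precomposition of a singular cube with an automorphism of `I^n`. -/
def SingularCube.comp {n : ℕ} (σ : SingularCube G n) (g : cube n ≃g cube n) : SingularCube G n where
  toFun t := σ.toFun (g t)
  map_adj _ _ h := σ.map_adj _ _ (g.map_rel_iff.2 h)

theorem SingularCube.image_comp {n : ℕ} (σ : SingularCube G n) (g : cube n ≃g cube n) :
    (σ.comp g).image = σ.image := by
  refine SimpleGraph.Subgraph.ext ?_ ?_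
  · exact g.surjective.range_comp σ.toFun
  · ext v w
    constructor
    · rintro ⟨h, x, y, hxy, rfl, rfl⟩
      exact ⟨h, g x, g y, g.map_rel_iff.2 hxy, rfl, rfl⟩
    · rintro ⟨h, x, y, hxy, rfl, rfl⟩
      refine ⟨h, g.symm x, g.symm y, g.symm.map_rel_iff.2 hxy, ?_, ?_⟩ <;>
        exact congrArg σ.toFun (g.apply_symm_apply _)

theorem SingularCube.comp_injective {n : ℕ} {σ : SingularCube G n}
    (h : Function.Injective σ.toFun) (g : cube n ≃g cube n) :
    Function.Injective (σ.comp g).toFun :=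
  h.comp g.injective

theorem hammingDist_update {n : ℕ} (x y : Fin n → Bool) (i : Fin n) (h : x i ≠ y i) :
    hammingDist (Function.update x i (y i)) y + 1 = hammingDist x y := by
  obtain ⟨m, rfl⟩ : ∃ m, n = m + 1 := ⟨n - 1, by have := i.pos; omega⟩
  rw [← i.insertNth_self_removeNth x, ← i.insertNth_self_removeNth y] at h ⊢
  rw [Fin.update_insertNth, hammingDist_insertNth, hammingDist_insertNth]
  simp at h ⊢
  rw [if_neg h]
  omega

theorem hammingDist_map_le {n : ℕ} (g : cube n ≃g cube n) (x y : Fin n → Bool) :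
    hammingDist (g x) (g y) ≤ hammingDist x y := by
  generalize hd : hammingDist x y = d
  induction d generalizing x with
  | zero => rw [hammingDist_eq_zero.1 hd, hammingDist_self]
  | succ d ih =>
    obtain ⟨i, hi⟩ : ∃ i, x i ≠ y i := by
      by_contra! hcon
      rw [funext hcon, hammingDist_self] at hd
      omega
    have h1 := hammingDist_update x y i hi
    have h2 : (cube n).Adj x (Function.update x i (y i)) := by
      change hammingDist _ _ = 1
      have h3 := hammingDist_update x (Function.update x i (y i)) i (by simpa using hi)
      simpa using h3.symm
    have h4 : hammingDist (g x) (g (Function.update x i (y i))) = 1 := g.map_rel_iff.2 h2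
    have h5 := ih (Function.update x i (y i)) (by omega)
    have h6 := hammingDist_triangle (g x) (g (Function.update x i (y i))) (g y)
    omega

theorem hammingDist_map {n : ℕ} (g : cube n ≃g cube n) (x y : Fin n → Bool) :
    hammingDist (g x) (g y) = hammingDist x y := by
  refine le_antisymm (hammingDist_map_le g x y) ?_
  have h := hammingDist_map_le g.symm (g x) (g y)
  simpa using h

/-- The automorphisms of `I^n` are the signed permutations of the coordinates. -/
theorem exists_perm {n : ℕ} (g : cube n ≃g cube n) :
    ∃ (p : Equiv.Perm (Fin n)) (c : Fin n → Bool), ∀ t k, g t k = (t (p k) ^^ c k) := by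
  set o : Fin n → Bool := fun _ => false with h_o
  have hflip : ∀ (x y : Fin n → Bool), hammingDist x y = 1 → ∃ k, y = Function.update x k (!x k) := by
    intro x y h
    obtain ⟨i, hi⟩ : ∃ i, x i ≠ y i := by
      by_contra! hcon
      rw [funext hcon, hammingDist_self] at h
      omega
    have h1 := hammingDist_update x y i hi
    refine ⟨i, ?_⟩
    rw [show (!x i) = y i by cases hx : x i <;> cases hy : y i <;> simp_all]
    exact (hammingDist_eq_zero.1 (by omega)).symm
  have hdist : ∀ (x u : Fin n → Bool) (k : Fin n),
      (hammingDist x (Function.update u k (!u k)) < hammingDist x u ↔ x k ≠ u k) := by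
    intro x u k
    by_cases hk : x k = u k
    · have h1 := hammingDist_update (Function.update u k (!u k)) x k (by simp [hk])
      rw [Function.update_idem, hk, Function.update_eq_self, hammingDist_comm,
        hammingDist_comm _ x] at h1
      simp only [hk, ne_eq, not_true_eq_false, iff_false]
      omega
    · have h1 := hammingDist_update u x k (fun h => hk h.symm)
      rw [show x k = !u k by cases hx : x k <;> cases hy : u k <;> simp_all,
        hammingDist_comm, hammingDist_comm u] at h1
      simp only [ne_eq, hk, not_false_eq_true, iff_true]
      omega
  have hbasis : ∀ j, hammingDist o (Function.update o j (!o j)) = 1 := by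
    intro j
    have h3 := hammingDist_update o (Function.update o j (!o j)) j (by simp)
    simpa using h3.symm
  have hex : ∀ j, ∃ k, g (Function.update o j (!o j)) = Function.update (g o) k (!g o k) := fun j =>
    hflip _ _ (by rw [hammingDist_map]; exact hbasis j)
  choose q hq using hex
  have hqinj : Function.Injective q := by
    intro i j hij
    have h := hq i
    rw [hij, ← hq j] at h
    have h' := congrFun (g.injective h) i
    by_contra hne
    simp [Function.update_of_ne hne] at h'
  let e : Equiv.Perm (Fin n) := Equiv.ofBijective q (Finite.injective_iff_bijective.1 hqinj)
  refine ⟨e.symm, g o, fun t k => ?_⟩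
  obtain ⟨j, rfl⟩ := e.surjective k
  rw [Equiv.symm_apply_apply]
  change g t (q j) = (t j ^^ g o (q j))
  have h1 := hdist t o j
  have h2 := hdist (g t) (g o) (q j)
  rw [← hq, hammingDist_map, hammingDist_map, h1] at h2
  revert h2
  simp only [h_o]
  cases t j <;> cases g t (q j) <;> cases g (fun _ => false) (q j) <;> simp

/-- The sign `1` of `false` and `-1` of `true`. -/
def sg (b : Bool) : ℤ := if b then -1 else 1

theorem linearPart_apply {n : ℕ} {g : (Fin n → Bool) → (Fin n → Bool)} {p : Fin n → Fin n}
    {c : Fin n → Bool} (hg : ∀ t k, g t k = (t (p k) ^^ c k)) (k j : Fin n) :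
    linearPart g k j = sg (c k) * if p k = j then 1 else 0 := by
  simp only [linearPart, Matrix.of_apply, hg]
  by_cases h : p k = j
  · subst h
    cases c k <;> simp [bit, sg]
  · simp [h]

theorem det_linearPart {n : ℕ} {g : (Fin n → Bool) → (Fin n → Bool)} {p : Equiv.Perm (Fin n)}
    {c : Fin n → Bool} (hg : ∀ t k, g t k = (t (p k) ^^ c k)) :
    (linearPart g).det = (∏ k, sg (c k)) * (Equiv.Perm.sign p : ℤ) := by
  have h : linearPart g = Matrix.diagonal (fun k => sg (c k)) * p.permMatrix ℤ := by
    ext k j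
    rw [linearPart_apply hg, Matrix.diagonal_mul, Equiv.Perm.permMatrix, PEquiv.toMatrix_apply]
    simp [eq_comm]
  rw [h, Matrix.det_mul, Matrix.det_diagonal, Matrix.det_permutation, Int.cast_id]

theorem det_linearPart_comp {n : ℕ} (g h : cube n ≃g cube n) :
    (linearPart fun t => g (h t)).det = (linearPart h).det * (linearPart g).det := by
  obtain ⟨p, c, hp⟩ := exists_perm g
  obtain ⟨q, d, hq⟩ := exists_perm h
  have hgh : ∀ t k, g (h t) k = (t ((q * p) k) ^^ (d (p k) ^^ c k)) := by
    intro t k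
    rw [hp, hq, Equiv.Perm.mul_apply, Bool.xor_assoc]
  have hmul : ∀ a b, sg (a ^^ b) = sg a * sg b := by decide
  rw [det_linearPart hp, det_linearPart hq, det_linearPart hgh]
  simp only [hmul, Finset.prod_mul_distrib, Equiv.Perm.sign_mul, Units.val_mul]
  rw [Equiv.prod_comp p (fun k => sg (d k))]
  ring

theorem CharMaps.exists_eq_chart_comp (χ : CharMaps G) {n : ℕ} (σ : SingularCube G n)
    (h : Function.Injective σ.toFun) :
    ∃ g : cube n ≃g cube n, σ = (χ.chart (σ.cell h)).comp g := by
  let e : cube n ≃g σ.image.coe :=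
    { toEquiv := Equiv.ofInjective σ.toFun h
      map_rel_iff' := by
        intro x y
        constructor
        · rintro ⟨-, x', y', hxy, hx, hy⟩
          rwa [← h hx, ← h hy]
        · intro hxy
          exact ⟨(σ.map_adj x y hxy).resolve_right fun e => hxy.ne (h e), x, y, hxy, rfl, rfl⟩ }
  refine ⟨e.trans (χ n (σ.cell h)).symm, ?_⟩
  ext t
  exact (congrArg Subtype.val ((χ n (σ.cell h)).apply_symm_apply (e t))).symm

theorem CharMaps.sign_eq (χ : CharMaps G) {n : ℕ} (σ : SingularCube G n)
    (h : Function.Injective σ.toFun) (g : cube n ≃g cube n)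
    (hg : σ = (χ.chart (σ.cell h)).comp g) : χ.sign σ h = (linearPart g).det := by
  unfold CharMaps.sign
  congr 2
  funext t
  have : σ.toFun t = (χ.chart (σ.cell h)).toFun (g t) := congrFun (congrArg SingularCube.toFun hg) t
  rw [this]
  exact Function.leftInverse_invFun (χ.chart_injective _) _

theorem CharMaps.cellChain_comp (χ : CharMaps G) {n : ℕ} (σ : SingularCube G n)
    (h : Function.Injective σ.toFun) (g : cube n ≃g cube n) :
    χ.cellChain (σ.comp g) (SingularCube.comp_injective h g) =
      (linearPart g).det • χ.cellChain σ h := by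
  obtain ⟨e, he⟩ := χ.exists_eq_chart_comp σ h
  have hc : (σ.comp g).cell (SingularCube.comp_injective h g) = σ.cell h :=
    Subtype.ext (σ.image_comp g)
  rw [CharMaps.cellChain, CharMaps.cellChain, χ.sign_eq σ h e he,
    χ.sign_eq (σ.comp g) (SingularCube.comp_injective h g) (g.trans e)]
  · rw [hc, Finsupp.smul_single, smul_eq_mul]
    congr 1
    exact det_linearPart_comp e g
  · rw [hc]
    ext t
    exact congrFun (congrArg SingularCube.toFun he) (g t)

theorem CharMaps.cellChain_congr (χ : CharMaps G) {n : ℕ} {σ τ : SingularCube G n} (e : σ = τ)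
    (h : Function.Injective σ.toFun) :
    χ.cellChain σ h = χ.cellChain τ (e ▸ h) := by
  subst e; rfl

theorem CharMaps.bdChain_congr (χ : CharMaps G) {n : ℕ} {σ τ : SingularCube G (n + 1)} (e : σ = τ)
    (h : Function.Injective σ.toFun) :
    χ.bdChain σ h = χ.bdChain τ (e ▸ h) := by
  subst e; rfl

/-- An automorphism of `I^{n+1}` maps faces to faces. -/
theorem exists_face {n : ℕ} (g : cube (n + 1) ≃g cube (n + 1)) {p : Equiv.Perm (Fin (n + 1))}
    {c : Fin (n + 1) → Bool} (hg : ∀ t k, g t k = (t (p k) ^^ c k)) (k : Fin (n + 1)) (a : Bool) :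
    ∃ h : cube n ≃g cube n,
      (∀ t, g ((p k).insertNth a t) = k.insertNth (a ^^ c k) (h t : Fin n → Bool)) ∧
      (linearPart g).det = (-1) ^ ((k : ℕ) + (p k : ℕ)) * sg (c k) * (linearPart h).det := by
  have hins : ∀ t : Fin n → Bool, g ((p k).insertNth a t) =
      k.insertNth (a ^^ c k) (k.removeNth (g ((p k).insertNth a t))) := by
    intro t
    rw [Fin.eq_insertNth_iff]
    exact ⟨by rw [hg]; simp, rfl⟩
  have hd : ∀ x y : Fin n → Bool,
      hammingDist (k.removeNth (g ((p k).insertNth a x)) : Fin n → Bool)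
        (k.removeNth (g ((p k).insertNth a y))) = hammingDist x y := by
    intro x y
    have h1 := hammingDist_map g ((p k).insertNth a x) ((p k).insertNth a y)
    rw [hins x, hins y, hammingDist_insertNth, hammingDist_insertNth] at h1
    simpa using h1
  have hinj : Function.Injective
      fun t : Fin n → Bool => (k.removeNth (g ((p k).insertNth a t)) : Fin n → Bool) := by
    intro x y hxy
    have h1 := hd x y
    rw [show k.removeNth (g ((p k).insertNth a x)) = k.removeNth (g ((p k).insertNth a y)) from hxy,
      hammingDist_self] at h1
    exact hammingDist_eq_zero.1 h1.symm
  let h : cube n ≃g cube n :=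
    { toEquiv := Equiv.ofBijective _ (Finite.injective_iff_bijective.1 hinj)
      map_rel_iff' := by
        intro x y
        change hammingDist _ _ = 1 ↔ hammingDist _ _ = 1
        exact iff_of_eq (congrArg (· = 1) (hd x y)) }
  refine ⟨h, hins, ?_⟩
  rw [Matrix.det_succ_column _ (p k), Finset.sum_eq_single k]
  · have hsub : (linearPart g).submatrix k.succAbove (p k).succAbove = linearPart h := by
      ext i j
      rw [Matrix.submatrix_apply, linearPart_apply hg]
      have hh : ∀ t i, h t i =
          (((p k).insertNth a t : Fin (n + 1) → Bool) (p (k.succAbove i)) ^^ c (k.succAbove i)) := by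
        intro t i
        change g ((p k).insertNth a t) (k.succAbove i) = _
        rw [hg]
      obtain ⟨l, hl⟩ := Fin.exists_succAbove_eq
        (show p (k.succAbove i) ≠ p k from fun e => Fin.succAbove_ne k i (p.injective e))
      simp only [linearPart, Matrix.of_apply, hh, ← hl, Fin.insertNth_apply_succAbove,
        Fin.succAbove_right_inj]
      by_cases hlj : l = j
      · subst hlj
        cases c (k.succAbove i) <;> simp [bit, sg]
      · simp [hlj]
    rw [hsub, linearPart_apply hg, if_pos rfl, mul_one]
  · intro i _ hi
    rw [linearPart_apply hg, if_neg (fun e => hi (p.injective e))]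
    simp
  · simp

theorem CharMaps.bdChain_comp (χ : CharMaps G) {n : ℕ} (σ : SingularCube G (n + 1))
    (h : Function.Injective σ.toFun) (g : cube (n + 1) ≃g cube (n + 1)) :
    χ.bdChain (σ.comp g) (SingularCube.comp_injective h g) =
      (linearPart g).det • χ.bdChain σ h := by
  obtain ⟨p, c, hp⟩ := exists_perm g
  unfold CharMaps.bdChain
  rw [← Equiv.sum_comp p, Finset.smul_sum]
  refine Finset.sum_congr rfl fun k _ => ?_
  have key : ∀ a, (linearPart g).det •
      χ.cellChain (σ.face k (a ^^ c k)) (SingularCube.face_injective h k _) =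
      ((-1) ^ ((k : ℕ) + (p k : ℕ)) * sg (c k)) • χ.cellChain ((σ.comp g).face (p k) a)
        (SingularCube.face_injective (SingularCube.comp_injective h g) _ _) := by
    intro a
    obtain ⟨f, hf, hdet⟩ := exists_face g hp k a
    have e : (σ.comp g).face (p k) a = (σ.face k (a ^^ c k)).comp f := by
      ext t
      exact congrArg σ.toFun (hf t)
    rw [χ.cellChain_congr e, χ.cellChain_comp _ (SingularCube.face_injective h k _), hdet, smul_smul]
  have hs : (-1 : ℤ) ^ ((p k : ℕ) + 1) =
      (-1 : ℤ) ^ ((k : ℕ) + 1) * (-1) ^ ((k : ℕ) + (p k : ℕ)) := by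
    rw [← pow_add, show (k : ℕ) + 1 + (k + p k) = (p k : ℕ) + 1 + 2 * k by ring, pow_add _ _ (2 * _),
      pow_mul]
    simp
  have h0 := key false
  have h1 := key true
  rw [smul_comm (linearPart g).det, smul_sub (linearPart g).det, hs, mul_smul]
  congr 1
  cases hc : c k
  · simp only [hc, Bool.xor_false, sg] at h0 h1
    rw [h0, h1, ← smul_sub]
    simp
  · simp only [hc, Bool.xor_true, sg, Bool.not_false, Bool.not_true] at h0 h1
    rw [h0, h1, ← smul_sub]
    simp only [if_true, mul_neg, mul_one, neg_smul, ← smul_neg, neg_sub]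

theorem CharMaps.cellBd_cellChain (χ : CharMaps G) {n : ℕ} (σ : SingularCube G (n + 1))
    (h : Function.Injective σ.toFun) : χ.cellBd n (χ.cellChain σ h) = χ.bdChain σ h := by
  obtain ⟨g, hg⟩ := χ.exists_eq_chart_comp σ h
  rw [CharMaps.cellChain, CharMaps.cellBd, Finsupp.linearCombination_single,
    χ.sign_eq σ h g hg, ← χ.bdChain_comp]
  exact (χ.bdChain_congr hg h).symm

theorem CharMaps.cellBd_cellBd (χ : CharMaps G) (n : ℕ) : χ.cellBd n ∘ₗ χ.cellBd (n + 1) = 0 := by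
  refine Finsupp.lhom_ext' fun Q => LinearMap.ext_ring ?_
  simp only [LinearMap.comp_apply, Finsupp.lsingle_apply, LinearMap.zero_apply]
  have h := χ.chart_injective Q
  rw [show χ.cellBd (n + 1) (Finsupp.single Q 1) = χ.bdChain (χ.chart Q) h by
    rw [CharMaps.cellBd, Finsupp.linearCombination_single, one_smul]]
  rw [CharMaps.bdChain, map_sum]
  simp only [map_smul, map_sub, χ.cellBd_cellChain]
  exact sum_faces_eq_zero
    (fun j b i a => χ.cellChain (((χ.chart Q).face j b).face i a)
      (SingularCube.face_injective (SingularCube.face_injective h _ _) _ _))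
    (fun j b i a => χ.cellChain_congr (face_face j i b a _) _)

/-- The cellular chain complex `C^cell_*(CW^□(G))`: the free abelian groups on the cells, with the
cellular boundary. -/
noncomputable def cellComplex (χ : CharMaps G) : ChainComplex (ModuleCat.{u} ℤ) ℕ :=
  ChainComplex.of (fun n => ModuleCat.of ℤ (Cell G n →₀ ℤ)) (fun n => ModuleCat.ofHom (χ.cellBd n))
    (fun n => by
      rw [← ModuleCat.ofHom_comp]
      exact congrArg ModuleCat.ofHom (χ.cellBd_cellBd n))

/-- The homomorphism `C^cell_n(CW^□(G)) → H^{[n]}_n(G)` that maps a cell to the class of its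
characteristic map, viewed as a singular `n`-cube. -/
noncomputable def cellToEdge (χ : CharMaps G) (n : ℕ) :
    (cellComplex χ).X n ⟶ (edgeComplex G).X n :=
  ModuleCat.ofHom (Y := (grComplex G n).homology n)
    (Finsupp.linearCombination ℤ fun Q : Cell G n => edgeClass (χ.chart Q))

end DiscreteCubical

namespace DiscreteCubical

open CategoryTheory

variable {V : Type u} {G : SimpleGraph V}

/-! ### Noninjective cubes and the presentation of `H^{[n]}_n(G)` -/

/-! An `n`-cube has degree below `n` exactly when it is not injective. So `C^{[n]}_n` is generated
by the injective cubes, `C^{[n]}_{n-1}` is zero, and `C^{[n]}_{n+1}` is generated by noninjective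
cubes. Thus `H^{[n]}_n` has the singular `n`-cubes as generators, noninjective ones being zero, and
its relations are the boundaries of noninjective `(n+1)`-cubes (`sum_edgeClass_faces_eq_zero`,
`exists_of_homologyClass_eq_zero`). In these terms `d_1` is the alternating sum of faces
(`edgeD_edgeClass`).

Reparametrizing a cube by an automorphism of `I^n` multiplies its class by the determinant
(`edgeClass_comp`): for generators of the automorphism group, a noninjective cube has the original
and the reparametrized cube as its only possibly injective faces. Hence the map from cellular chains
is a chain map and is surjective in every degree, for every `G`.

For injectivity, send an injective cube to its signed image cell and other cubes to zero
(`cubeChain`). This inverts the map provided it kills the boundary of each noninjective `(n+1)`-cube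
`τ` (`sum_cubeChain_faces_eq_zero`). Consider the coefficient of a cell `Q`. If faces in two
different directions have image `Q`, the whole boundary cancels in pairs. Otherwise
quasimonophobicity makes exactly two opposite faces have image `Q`. As `Q` is induced, these differ
by an automorphism moving each vertex by at most one edge. It preserves orientation, and the two
faces cancel, or it is a reflection, which would produce a face with image `Q` in another direction.

On homology, surjectivity in degree `n + 1` and injectivity in degree `n` give injectivity;
surjectivity in degree `n` and injectivity in degree `n - 1` give surjectivity. -/

theorem degree_lt_iff {n : ℕ} (σ : SingularCube G n) :
    degree σ < n ↔ ¬ Function.Injective σ.toFun := by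
  rw [(degree_le σ).lt_iff_ne]
  refine not_congr ⟨fun h => ?_, fun h => le_antisymm (degree_le σ) ?_⟩
  -- The supremum is attained: the set of dimensions is bounded, and it is nonempty because every
  -- cube is injective on a vertex (`S = ∅`).
  · obtain ⟨S, c, hS, hinj⟩ :=
      Nat.sSup_mem (s := {k | ∃ (S : Finset (Fin n)) (c : Fin n → Bool), S.card = k ∧
        Set.InjOn σ.toFun {t | ∀ i, i ∉ S → t i = c i}})
        ⟨0, ∅, fun _ => false, rfl, fun x hx y hy _ => funext fun i =>
          (hx i (Finset.notMem_empty i)).trans (hy i (Finset.notMem_empty i)).symm⟩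
        ⟨_, degree_bddAbove σ⟩
    have hS' : S = Finset.univ := by
      rw [← Finset.card_eq_iff_eq_univ, Fintype.card_fin, hS]
      exact h
    subst hS'
    intro x y hxy
    exact hinj (fun i hi => absurd (Finset.mem_univ i) hi)
      (fun i hi => absurd (Finset.mem_univ i) hi) hxy
  · exact le_csSup ⟨_, degree_bddAbove σ⟩
      ⟨Finset.univ, fun _ => false, by simp, h.injOn⟩

theorem IsDegenerate.not_injective {n : ℕ} {σ : SingularCube G n} (h : IsDegenerate σ) :
    ¬ Function.Injective σ.toFun := by
  match n, σ, h with
  | 0, _, h => exact h.elim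
  | n + 1, σ, ⟨i, hi⟩ =>
    intro hinj
    have h1 := hinj (congrFun (congrArg SingularCube.toFun hi) fun _ => false)
    simpa using congrFun h1 i

/-- Induction on the generation of `C^{k-1}_n(G)` by the cubes of degree `< k`. -/
theorem fil_induction {k n : ℕ} {p : fil G k n → Prop} (h0 : p 0)
    (hadd : ∀ x y, p x → p y → p (x + y)) (hsmul : ∀ (m : ℤ) x, p x → p (m • x))
    (hof : ∀ (σ : SingularCube G n) (hσ : degree σ < k),
      p ⟨chainOf σ, Submodule.subset_span ⟨σ, hσ, rfl⟩⟩) (x : fil G k n) : p x := by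
  obtain ⟨x, hx⟩ := x
  induction hx using Submodule.span_induction with
  | mem x h =>
    obtain ⟨σ, hσ, rfl⟩ := h
    exact hof σ hσ
  | zero => exact h0
  | add x y _ _ hx hy => exact hadd _ _ hx hy
  | smul m x _ hx => exact hsmul m _ hx

theorem grOf_eq_zero {n : ℕ} {σ : SingularCube G n} (h : ¬ Function.Injective σ.toFun) :
    grOf σ = 0 := by
  refine (Submodule.Quotient.mk_eq_zero _).2 ?_
  exact Submodule.subset_span ⟨σ, (degree_lt_iff σ).2 h, rfl⟩

/-- The homomorphism `C^{[n]}_n(G) → H^{[n]}_n(G)`. -/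
noncomputable def homologyClass (G : SimpleGraph V) (n : ℕ) :
    Gr G n n →ₗ[ℤ] (grComplex G n).homology n :=
  (grToHomology G n).hom

theorem edgeClass_eq {n : ℕ} (σ : SingularCube G n) :
    edgeClass σ = homologyClass G n (grOf σ) := rfl

theorem edgeClass_eq_zero {n : ℕ} {σ : SingularCube G n} (h : ¬ Function.Injective σ.toFun) :
    edgeClass σ = 0 := by
  rw [edgeClass_eq, grOf_eq_zero h, map_zero]

/-- The alternating sum of the faces of an `(n+1)`-cube in `C^{[n]}_n(G)`. -/
theorem mk_sum_faces {n : ℕ} (τ : SingularCube G (n + 1))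
    (x : fil G (n + 1) n) (hx : x.1 = bd G n (chainOf τ)) :
    (Submodule.Quotient.mk x : Gr G n n) = ∑ i : Fin (n + 1), (-1 : ℤ) ^ ((i : ℕ) + 1) •
      (grOf (τ.face i false) - grOf (τ.face i true)) := by
  have : x = ∑ i : Fin (n + 1), (-1 : ℤ) ^ ((i : ℕ) + 1) •
      ((⟨chainOf (τ.face i false), Submodule.subset_span
          ⟨_, Nat.lt_succ_of_le (degree_le _), rfl⟩⟩ : fil G (n + 1) n) -
        ⟨chainOf (τ.face i true), Submodule.subset_span
          ⟨_, Nat.lt_succ_of_le (degree_le _), rfl⟩⟩) := by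
    refine Subtype.ext ?_
    rw [hx, bd_chainOf, Submodule.coe_sum]
    rfl
  rw [this, ← Submodule.mkQ_apply, map_sum]
  simp only [map_smul, map_sub]
  rfl

theorem grComplex_d (n : ℕ) (x : Gr G n (n + 1)) :
    ((grComplex G n).d (n + 1) n).hom x = bdGr G n n x := by
  simp only [grComplex, ChainComplex.of_d]
  rfl

/-- Every chain of degree `n` is a cycle here, so the boundary followed by the lift to cycles is
`toCycles`, which the projection to homology kills. -/
theorem d_grToHomology (n : ℕ) : (grComplex G n).d (n + 1) n ≫ grToHomology G n = 0 := by
  have : (grComplex G n).d (n + 1) n ≫ grToHomology G n =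
      (grComplex G n).toCycles (n + 1) n ≫ (grComplex G n).homologyπ n := by
    rw [grToHomology, ← Category.assoc]
    congr 1
    rw [← cancel_mono ((grComplex G n).iCycles n)]
    simp
  rw [this, HomologicalComplex.toCycles_comp_homologyπ]

/-- In `H^{[n]}_n(G)`, the boundary of a noninjective cube is zero. -/
theorem sum_edgeClass_faces_eq_zero {n : ℕ} (τ : SingularCube G (n + 1))
    (h : ¬ Function.Injective τ.toFun) :
    ∑ i : Fin (n + 1), (-1 : ℤ) ^ ((i : ℕ) + 1) •
      (edgeClass (τ.face i false) - edgeClass (τ.face i true)) = 0 := by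
  let y : fil G (n + 1) (n + 1) :=
    ⟨chainOf τ, Submodule.subset_span ⟨τ, (degree_lt_iff τ).2 h, rfl⟩⟩
  have h1 : homologyClass G n (bdGr G n n (Submodule.Quotient.mk y)) = 0 := by
    rw [← grComplex_d]
    exact congrArg (fun f => f.hom (Submodule.Quotient.mk y : Gr G n (n + 1)))
      (d_grToHomology (G := G) n)
  have h2 : bdGr G n n (Submodule.Quotient.mk y) = _ := mk_sum_faces τ (bdFil G (n + 1) n y) rfl
  rw [h2, map_sum] at h1
  simpa only [map_zsmul, map_sub, ← edgeClass_eq] using h1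

/-! ### Generators and relations of `H^{[n]}_n` -/

instance grToHomology_epi (n : ℕ) : Epi (grToHomology G n) := by
  have : Epi ((grComplex G n).liftCycles (𝟙 ((grComplex G n).X n)) _ rfl
      (by rw [grComplex_d_eq_zero, Limits.comp_zero])) := by
    have h : IsIso ((grComplex G n).iCycles n) :=
      (grComplex G n).isIso_iCycles n _ rfl (grComplex_d_eq_zero G n _)
    have h2 := (grComplex G n).liftCycles_i (𝟙 ((grComplex G n).X n)) _ rfl
      (by rw [grComplex_d_eq_zero, Limits.comp_zero])
    rw [← IsIso.eq_comp_inv] at h2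
    rw [h2]
    infer_instance
  exact epi_comp _ _

theorem exists_toCycles_of_homologyπ_eq_zero {K : ChainComplex (ModuleCat.{u} ℤ) ℕ} (n : ℕ)
    (z : K.cycles n) (h : K.homologyπ n z = 0) : ∃ y, K.toCycles (n + 1) n y = z := by
  have hex : (ShortComplex.mk _ _ (K.toCycles_comp_homologyπ (n + 1) n)).Exact :=
    ShortComplex.exact_of_g_is_cokernel _ (K.homologyIsCokernel (n + 1) n (ChainComplex.prev ℕ n))
  rw [ShortComplex.moduleCat_exact_iff] at hex
  exact hex z h

/-- The relations half of the presentation: exactness at the cycles, transported to chains along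
`iCycles`. -/
theorem exists_of_homologyClass_eq_zero (n : ℕ) (x : Gr G n n)
    (h : homologyClass G n x = 0) : ∃ y, bdGr G n n y = x := by
  obtain ⟨y, hy⟩ := exists_toCycles_of_homologyπ_eq_zero n
    (((grComplex G n).liftCycles (𝟙 ((grComplex G n).X n)) _ rfl
      (by rw [grComplex_d_eq_zero, Limits.comp_zero])).hom x) h
  refine ⟨y, (grComplex_d n y).symm.trans ?_⟩
  have h1 := congrArg ((grComplex G n).iCycles n).hom hy
  have h2 := congrArg (fun f => f.hom x) ((grComplex G n).liftCycles_i (𝟙 ((grComplex G n).X n)) _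
    rfl (by rw [grComplex_d_eq_zero, Limits.comp_zero]))
  have h3 := congrArg (fun f => f.hom y) ((grComplex G n).toCycles_i (n + 1) n)
  exact h3.symm.trans (h1.trans h2)

theorem span_grOf (n : ℕ) : Submodule.span ℤ (Set.range (grOf : SingularCube G n → _)) = ⊤ := by
  rw [eq_top_iff]
  rintro x -
  obtain ⟨x, rfl⟩ := Submodule.mkQ_surjective _ x
  induction x using fil_induction with
  | h0 => rw [map_zero]; exact Submodule.zero_mem _
  | hadd x y hx hy => rw [map_add]; exact Submodule.add_mem _ hx hy
  | hsmul m x hx => rw [map_smul]; exact Submodule.smul_mem _ _ hx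
  | hof σ hσ => exact Submodule.subset_span ⟨σ, rfl⟩

theorem homologyClass_surjective (n : ℕ) : Function.Surjective (homologyClass G n) :=
  (ModuleCat.epi_iff_surjective (grToHomology G n)).1 inferInstance

theorem span_edgeClass (n : ℕ) :
    Submodule.span ℤ (Set.range (edgeClass : SingularCube G n → _)) = ⊤ := by
  have h : Set.range (edgeClass : SingularCube G n → _) =
      homologyClass G n '' Set.range (grOf : SingularCube G n → Gr G n n) :=
    Set.range_comp (homologyClass G n) grOf
  rw [h, Submodule.span_image, span_grOf, Submodule.map_top, LinearMap.range_eq_top]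
  exact homologyClass_surjective n

/-! ### The edge differential on classes of cubes -/

/-- The boundary of `C^{k+1}_{k+1}(G)`, with values in `C^k_k(G) = C_k(G)`. -/
noncomputable def bdTop (G : SimpleGraph V) (k : ℕ) :
    (filComplex G (k + 2)).X (k + 1) ⟶ (filComplex G (k + 1)).X k :=
  ModuleCat.ofHom (X := fil G (k + 2) (k + 1)) (Y := fil G (k + 1) k)
    (((bd G k).comp (fil G (k + 2) (k + 1)).subtype).codRestrict _ fun x => by
      rw [fil_eq_top (Nat.lt_succ_self k)]; trivial)

/-- The connecting homomorphism on a chain of cycles of top degree. -/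
theorem comp_δ_comp_homologyMap {K₁ K₂ K₃ L : ChainComplex (ModuleCat.{u} ℤ) ℕ} {f : K₁ ⟶ K₂}
    {g : K₂ ⟶ K₃} {w : f ≫ g = 0} (hS : (ShortComplex.mk f g w).ShortExact) (p : K₁ ⟶ L) {k : ℕ}
    (h₃ : K₃.d (k + 1) ((ComplexShape.down ℕ).next (k + 1)) = 0)
    (hL : L.d k ((ComplexShape.down ℕ).next k) = 0) (b : K₂.X (k + 1) ⟶ K₁.X k)
    (hb : b ≫ f.f k = K₂.d (k + 1) k) :
    g.f (k + 1) ≫ (K₃.liftCycles (𝟙 _) _ rfl (by rw [h₃, Limits.comp_zero]) ≫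
        K₃.homologyπ (k + 1)) ≫
      hS.δ (k + 1) k (ComplexShape.down_mk (k + 1) k rfl) ≫ HomologicalComplex.homologyMap p k =
    b ≫ p.f k ≫ L.liftCycles (𝟙 _) _ rfl (by rw [hL, Limits.comp_zero]) ≫ L.homologyπ k := by
  have h3 : K₃.d (k + 1) k = 0 := by
    rwa [ChainComplex.next_nat_succ] at h₃
  -- The snake recipe applied to a generalized element: `g.f (k + 1)` lifts to the identity of `K₂.X
  -- (k + 1)`, and `b` is a preimage in `K₁` of the boundary of this lift.
  have h := hS.δ_eq (k + 1) k (ComplexShape.down_mk (k + 1) k rfl) (g.f (k + 1))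
    (by rw [h3, Limits.comp_zero]) (𝟙 _) (Category.id_comp _) b
    (hb.trans (Category.id_comp _).symm) _ rfl
  have e1 : K₃.liftCycles (g.f (k + 1)) k (ChainComplex.next_nat_succ k)
      (by rw [h3, Limits.comp_zero]) =
      g.f (k + 1) ≫ K₃.liftCycles (𝟙 _) _ rfl (by rw [h₃, Limits.comp_zero]) := by
    rw [← cancel_mono (K₃.iCycles (k + 1))]
    simp
  dsimp only at h
  rw [e1] at h
  simp only [Category.assoc] at h ⊢
  rw [reassoc_of% h, HomologicalComplex.homologyπ_naturality, ← Category.assoc,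
    ← Category.assoc, ← Category.assoc]
  congr 1
  rw [← cancel_mono (L.iCycles k)]
  simp

/-- No correction of the lift is needed: `C^k_k(G)` is all of `C_k(G)`, so the boundary of any
`(k+1)`-chain already lies in the subcomplex. -/
theorem filProj_edgeD (k : ℕ) :
    (filProj G (k + 1)).f (k + 1) ≫ grToHomology G (k + 1) ≫ edgeD G k =
      bdTop G k ≫ (filProj G k).f k ≫ grToHomology G k := by
  have h1 : bdTop G k ≫ (filIncl G (k + 1)).f k = (filComplex G (k + 2)).d (k + 1) k := by
    simp only [filComplex, ChainComplex.of_d]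
    rfl
  exact comp_δ_comp_homologyMap (filSeq_shortExact G (k + 1)) (filProj G k)
    (grComplex_d_eq_zero G (k + 1) _) (grComplex_d_eq_zero G k _) (bdTop G k) h1

theorem edgeD_edgeClass (k : ℕ) (σ : SingularCube G (k + 1)) :
    (edgeD G k).hom (edgeClass σ) = ∑ i : Fin (k + 1), (-1 : ℤ) ^ ((i : ℕ) + 1) •
      (edgeClass (σ.face i false) - edgeClass (σ.face i true)) := by
  let y : fil G (k + 2) (k + 1) :=
    ⟨chainOf σ, Submodule.subset_span ⟨σ, Nat.lt_succ_of_le (degree_le σ), rfl⟩⟩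
  have h := congrArg (fun f => f.hom y) (filProj_edgeD (G := G) k)
  refine Eq.trans h ?_
  have h2 := congrArg (homologyClass G k) (mk_sum_faces σ ((bdTop G k).hom y) rfl)
  refine Eq.trans h2 ?_
  rw [map_sum]
  simp only [map_zsmul, map_sub, ← edgeClass_eq]

/-! ### Automorphisms of the cube -/

theorem SingularCube.map_of_hammingDist_le {n : ℕ} (σ : SingularCube G n) {x y : Fin n → Bool}
    (h : hammingDist x y ≤ 1) : G.Adj (σ.toFun x) (σ.toFun y) ∨ σ.toFun x = σ.toFun y := by
  rcases Nat.le_one_iff_eq_zero_or_eq_one.1 h with h | h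
  · rw [hammingDist_eq_zero.1 h]; exact Or.inr rfl
  · exact σ.map_adj x y h

theorem SingularCube.not_injective_face {n : ℕ} (τ : SingularCube G (n + 1)) {i : Fin (n + 1)}
    {a : Bool} {x y : Fin (n + 1) → Bool} (hx : x i = a) (hy : y i = a) (hxy : x ≠ y)
    (h : τ.toFun x = τ.toFun y) : ¬ Function.Injective (τ.face i a).toFun := by
  intro hinj
  have hx' : i.insertNth a (i.removeNth x) = x := by rw [← hx, Fin.insertNth_self_removeNth]
  have hy' : i.insertNth a (i.removeNth y) = y := by rw [← hy, Fin.insertNth_self_removeNth]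
  refine hxy ?_
  rw [← hx', ← hy']
  congr 1
  refine hinj ?_
  simp only [SingularCube.face, hx', hy', h]

/-- The automorphism of the cube that moves the `j`-th coordinate to the place `i`, reflecting it
if `d` is `true`. -/
def moveCoord {n : ℕ} (i j : Fin (n + 1)) (d : Bool) : cube (n + 1) ≃g cube (n + 1) where
  toFun t := i.insertNth (t j ^^ d) (j.removeNth t)
  invFun t := j.insertNth (t i ^^ d) (i.removeNth t)
  left_inv t := by simp
  right_inv t := by simp
  map_rel_iff' := by
    intro x y
    change hammingDist (i.insertNth (x j ^^ d) (j.removeNth x) : Fin (n + 1) → Bool)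
      (i.insertNth (y j ^^ d) (j.removeNth y)) = 1 ↔ hammingDist x y = 1
    conv_rhs => rw [← j.insertNth_self_removeNth x, ← j.insertNth_self_removeNth y]
    rw [hammingDist_insertNth, hammingDist_insertNth]
    simp

theorem moveCoord_apply {n : ℕ} (i j : Fin (n + 1)) (d : Bool) (t : Fin (n + 1) → Bool) :
    moveCoord i j d t = i.insertNth (t j ^^ d) (j.removeNth t) := rfl

theorem det_linearPart_id {n : ℕ} : (linearPart fun t : Fin n → Bool => t).det = 1 := by
  rw [det_linearPart (p := 1) (c := fun _ => false) (by simp)]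
  simp [sg]

/-- The map induced between the facets is the identity, so only the sign of the cofactor expansion
and that of the reflection remain. -/
theorem det_moveCoord {n : ℕ} (i j : Fin (n + 1)) (d : Bool) :
    (linearPart (moveCoord i j d)).det = (-1) ^ ((i : ℕ) + (j : ℕ)) * sg d := by
  obtain ⟨p, c, hp⟩ := exists_perm (moveCoord i j d)
  have h : ∀ t : Fin (n + 1) → Bool, (t j ^^ d) = (t (p i) ^^ c i) := fun t => by
    rw [← hp, moveCoord_apply, Fin.insertNth_apply_same]
  have hc : c i = d := by simpa using (h fun _ => false).symm
  have hj : p i = j := by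
    by_contra hne
    have := h (Function.update (fun _ => false) j true)
    simp [Function.update_of_ne hne, hc] at this
  obtain ⟨f, hf, hdet⟩ := exists_face (moveCoord i j d) hp i false
  have hf' : (f : (Fin n → Bool) → (Fin n → Bool)) = fun t => t := by
    funext t
    have h1 := hf t
    rw [hj, hc, moveCoord_apply, Fin.insertNth_apply_same, Fin.removeNth_insertNth] at h1
    exact (Fin.insertNth_right_injective _ h1).symm
  rw [hdet, hj, hc, hf', det_linearPart_id, mul_one]

/-! ### Noninjective cubes joining a cube to its reparametrizations -/

theorem exists_predAbove_eq {n : ℕ} (i' j' : Fin (n + 1)) :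
    ∃ i : Fin (n + 2), j'.predAbove i = i' := by
  rcases le_or_gt i' j' with h | h
  · exact ⟨i'.castSucc, by
      rw [Fin.predAbove_of_le_castSucc _ _ (Fin.castSucc_le_castSucc_iff.2 h),
        Fin.castPred_castSucc]⟩
  · exact ⟨i'.succ, by
      rw [Fin.predAbove_of_castSucc_lt _ _
        ((Fin.castSucc_lt_castSucc_iff.2 h).trans Fin.castSucc_lt_succ), Fin.pred_succ]⟩

/-- The noninjective cube that connects `σ` with `σ.comp (moveCoord i' j' d)`. -/
def SingularCube.moveHomotopy {n : ℕ} (σ : SingularCube G (n + 1)) (i : Fin (n + 2))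
    (j' : Fin (n + 1)) (d : Bool) : SingularCube G (n + 2) where
  toFun t := σ.toFun ((j'.predAbove i).insertNth (d ^^ ((t i ^^ d) || t (i.succAbove j')))
    (j'.removeNth (i.removeNth t)))
  map_adj x y h := by
    -- Coordinates `i` and `i.succAbove j'` are merged into one: `t i || t j` for `d = false`, `t i
    -- && !t j` for `d = true`, with `j = i.succAbove j'`. Merging does not increase the Hamming
    -- distance, but may make it zero.
    refine σ.map_of_hammingDist_le ?_
    change hammingDist x y = 1 at h
    rw [← i.insertNth_self_removeNth x, ← i.insertNth_self_removeNth y,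
      ← j'.insertNth_self_removeNth (i.removeNth x), ← j'.insertNth_self_removeNth (i.removeNth y),
      hammingDist_insertNth, hammingDist_insertNth] at h
    rw [hammingDist_insertNth]
    change (if x i = y i then 0 else 1) + ((if x (i.succAbove j') = y (i.succAbove j') then 0 else 1)
      + _) = 1 at h
    generalize hammingDist (j'.removeNth (i.removeNth x)) (j'.removeNth (i.removeNth y)) = m at h ⊢
    generalize x i = a at h ⊢
    generalize y i = b at h ⊢
    generalize x (i.succAbove j') = a' at h ⊢
    generalize y (i.succAbove j') = b' at h ⊢
    revert h
    cases a <;> cases b <;> cases a' <;> cases b' <;> cases d <;> simp <;> omega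

theorem SingularCube.moveHomotopy_face_left {n : ℕ} (σ : SingularCube G (n + 1)) (i : Fin (n + 2))
    (j' : Fin (n + 1)) (d : Bool) :
    (σ.moveHomotopy i j' d).face i d = σ.comp (moveCoord (j'.predAbove i) j' d) := by
  ext t
  simp only [SingularCube.face, SingularCube.comp, SingularCube.moveHomotopy, moveCoord_apply,
    Fin.insertNth_apply_same, Fin.insertNth_apply_succAbove, Fin.removeNth_insertNth]
  simp [Bool.xor_comm]

theorem SingularCube.moveHomotopy_face_right {n : ℕ} (σ : SingularCube G (n + 1)) (i : Fin (n + 2))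
    (j' : Fin (n + 1)) (d : Bool) :
    (σ.moveHomotopy i j' d).face (i.succAbove j') false = σ := by
  ext t
  obtain ⟨a, s, rfl⟩ : ∃ a s, t = (j'.predAbove i).insertNth a s :=
    ⟨_, _, ((j'.predAbove i).insertNth_self_removeNth t).symm⟩
  simp only [SingularCube.face, SingularCube.moveHomotopy]
  have h := insertNth_insertNth (i.succAbove j') (j'.predAbove i) false a s
  rw [Fin.succAbove_succAbove_predAbove, Fin.predAbove_predAbove_succAbove] at h
  simp only [Fin.insertNth_apply_same]
  rw [h]
  simp only [Fin.insertNth_apply_same, Fin.removeNth_insertNth]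
  congr 2
  cases a <;> cases d <;> rfl

theorem SingularCube.moveHomotopy_face_other {n : ℕ} (σ : SingularCube G (n + 1)) (i : Fin (n + 2))
    (j' : Fin (n + 1)) (d : Bool) (k : Fin (n + 2)) (a : Bool) (h₁ : (k, a) ≠ (i, d))
    (h₂ : (k, a) ≠ (i.succAbove j', false)) :
    ¬ Function.Injective ((σ.moveHomotopy i j' d).face k a).toFun := by
  have hij := Fin.succAbove_ne i j'
  -- The merged coordinate is all that is seen of `p` and `q`. The base value `a` elsewhere puts the
  -- points on the face `(k, a)` when `k` is neither of the two directions.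
  have key : ∀ p q p' q', (d ^^ ((p ^^ d) || q)) = (d ^^ ((p' ^^ d) || q')) →
      (σ.moveHomotopy i j' d).toFun
        (Function.update (Function.update (fun _ => a) i p) (i.succAbove j') q) =
      (σ.moveHomotopy i j' d).toFun
        (Function.update (Function.update (fun _ => a) i p') (i.succAbove j') q') := by
    intro p q p' q' h
    simp only [SingularCube.moveHomotopy, Function.update_self, Function.update_of_ne hij.symm, h]
    congr 2
    funext l
    have h1 : i.succAbove (j'.succAbove l) ≠ i.succAbove j' := fun e =>
      Fin.succAbove_ne _ _ (Fin.succAbove_right_injective e)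
    simp only [Fin.removeNth, Function.update_of_ne h1, Function.update_of_ne (Fin.succAbove_ne i _)]
  -- Once one input of the disjunction is true, the other is irrelevant. This yields two points of
  -- the face with equal image.
  by_cases hk : k = i.succAbove j'
  · subst hk
    have ha : a = true := by
      by_contra h
      exact h₂ (by simp [h])
    refine SingularCube.not_injective_face _ (x := _) (y := _) ?_ ?_ ?_
      (key d true (!d) true (by simp))
    · simp [ha]
    · simp [ha]
    · intro h
      have := congrFun h i
      simp at this
  · refine SingularCube.not_injective_face _ (x := _) (y := _) ?_ ?_ ?_
      (key (!d) true (!d) false (by cases d <;> rfl))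
    · rw [Function.update_of_ne hk]
      by_cases hki : k = i
      · subst hki
        rw [Function.update_self]
        by_contra h
        exact h₁ (by cases a <;> cases d <;> simp_all)
      · rw [Function.update_of_ne hki]
    · rw [Function.update_of_ne hk]
      by_cases hki : k = i
      · subst hki
        rw [Function.update_self]
        by_contra h
        exact h₁ (by cases a <;> cases d <;> simp_all)
      · rw [Function.update_of_ne hki]
    · intro h
      have := congrFun h (i.succAbove j')
      simp at this

theorem SingularCube.not_injective_moveHomotopy {n : ℕ} (σ : SingularCube G (n + 1))
    (i : Fin (n + 2)) (j' : Fin (n + 1)) (d : Bool) :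
    ¬ Function.Injective (σ.moveHomotopy i j' d).toFun := fun h =>
  σ.moveHomotopy_face_other i j' d i (!d) (by simp) (by simp [(Fin.succAbove_ne i j').symm])
    (SingularCube.face_injective h _ _)

theorem eq_of_signs {A : Type*} [AddCommGroup A] {m n : ℕ} {d : Bool} {x y : A}
    (h : (-1 : ℤ) ^ m • (sg d • x - (-1 : ℤ) ^ n • y) = 0) : x = ((-1 : ℤ) ^ n * sg d) • y := by
  have h1 : sg d • x = (-1 : ℤ) ^ n • y := by
    rcases neg_one_pow_eq_or ℤ m with hm | hm <;> rw [hm] at h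
    · simpa [sub_eq_zero] using h
    · rwa [neg_smul, one_smul, neg_eq_zero, sub_eq_zero] at h
  rw [mul_comm, mul_smul, ← h1, smul_smul]
  cases d <;> simp [sg]

/-- An alternating sum over the faces of a cube that is supported in two directions. -/
theorem sum_faces_two_directions {A : Type*} [AddCommGroup A] {n : ℕ} (F : Fin (n + 2) → Bool → A)
    (k : Fin (n + 2)) (j : Fin (n + 1)) (hF : ∀ l a, l ≠ k → l ≠ k.succAbove j → F l a = 0) :
    ∑ l : Fin (n + 2), (-1 : ℤ) ^ ((l : ℕ) + 1) • (F l false - F l true) =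
      (-1 : ℤ) ^ ((k : ℕ) + 1) • ((F k false - F k true) -
        (-1 : ℤ) ^ ((j.predAbove k : ℕ) + (j : ℕ)) •
          (F (k.succAbove j) false - F (k.succAbove j) true)) := by
  rw [Finset.sum_eq_add k (k.succAbove j) (Fin.succAbove_ne k j).symm
    (fun l _ hl => by
      rw [hF l false hl.1 hl.2, hF l true hl.1 hl.2, sub_zero, smul_zero]) (by simp) (by simp)]
  have h4 : ∀ m : ℕ, (-1 : ℤ) ^ m * (-1) ^ m = 1 := fun m => by
    rw [← mul_pow]; simp
  have hs : (-1 : ℤ) ^ ((k.succAbove j : Fin (n + 2)) + 1 : ℕ) =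
      - ((-1) ^ ((k : ℕ) + 1) * (-1) ^ ((j.predAbove k : ℕ) + (j : ℕ))) := by
    have h3 := Fin.neg_one_pow_succAbove_add_predAbove (R := ℤ) k j
    rw [pow_add, pow_add] at h3
    rw [pow_succ, pow_succ, pow_add]
    linear_combination (-(-1 : ℤ) ^ (j.predAbove k : ℕ)) * h3 +
      (-1 : ℤ) ^ ((k.succAbove j : Fin (n + 2)) : ℕ) * h4 (j.predAbove k : ℕ)
  rw [hs, neg_smul, mul_smul, ← sub_eq_add_neg, ← smul_sub]

/-- The boundary of `moveHomotopy` vanishes in homology, and only its two distinguished faces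
contribute; their relative sign is the determinant. -/
theorem edgeClass_comp_moveCoord {n : ℕ} (σ : SingularCube G (n + 1)) (i j : Fin (n + 1))
    (d : Bool) : edgeClass (σ.comp (moveCoord i j d)) =
      (linearPart (moveCoord i j d)).det • edgeClass σ := by
  obtain ⟨k, rfl⟩ := exists_predAbove_eq i j
  have hkj := Fin.succAbove_ne k j
  have h0 : ∀ l a, (l, a) ≠ (k, d) → (l, a) ≠ (k.succAbove j, false) →
      edgeClass ((σ.moveHomotopy k j d).face l a) = 0 := fun l a h₁ h₂ =>
    edgeClass_eq_zero (σ.moveHomotopy_face_other k j d l a h₁ h₂)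
  have h := (sum_faces_two_directions (fun l a => edgeClass ((σ.moveHomotopy k j d).face l a)) k j
    fun l a h₁ h₂ => h0 l a (by simp [h₁]) (by simp [h₂])).symm.trans
    (sum_edgeClass_faces_eq_zero (σ.moveHomotopy k j d) (σ.not_injective_moveHomotopy k j d))
  -- In direction `k` only the face on side `d` survives; `sg d` is its sign in the difference.
  have h2 : edgeClass ((σ.moveHomotopy k j d).face k false) -
      edgeClass ((σ.moveHomotopy k j d).face k true) =
      sg d • edgeClass (σ.comp (moveCoord (j.predAbove k) j d)) := by
    cases d
    · rw [σ.moveHomotopy_face_left, h0 k true (by simp) (by simp)]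
      simp [sg]
    · rw [σ.moveHomotopy_face_left, h0 k false (by simp) (by simp [hkj.symm])]
      simp [sg]
  simp only [h2, σ.moveHomotopy_face_right] at h
  rw [h0 (k.succAbove j) true (by simp [hkj]) (by simp), sub_zero] at h
  rw [det_moveCoord]
  generalize edgeClass σ = y at h ⊢
  generalize edgeClass (σ.comp _) = x at h ⊢
  exact eq_of_signs h

/-- The automorphism of the cube given by a permutation of the coordinates and reflections. -/
def signedPerm {n : ℕ} (p : Equiv.Perm (Fin n)) (c : Fin n → Bool) : cube n ≃g cube n where
  toFun t k := t (p k) ^^ c k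
  invFun t k := t (p.symm k) ^^ c (p.symm k)
  left_inv t := by simp
  right_inv t := by simp
  map_rel_iff' := by
    intro x y
    change hammingDist (fun k => x (p k) ^^ c k) (fun k => y (p k) ^^ c k) = 1 ↔
      hammingDist x y = 1
    have : hammingDist (fun k => x (p k) ^^ c k) (fun k => y (p k) ^^ c k) = hammingDist x y := by
      simp only [hammingDist, Finset.card_filter, ne_eq, Bool.xor_left_inj]
      exact Equiv.sum_comp p fun k => if ¬ x k = y k then 1 else 0
    rw [this]

theorem signedPerm_apply {n : ℕ} (p : Equiv.Perm (Fin n)) (c t : Fin n → Bool) (k : Fin n) :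
    signedPerm p c t k = (t (p k) ^^ c k) := rfl

/-- Automorphisms are signed permutations, and these are generated by adjacent transpositions and
single reflections, which are both of the form `moveCoord`. -/
theorem cubeIso_induction {n : ℕ} {P : (cube (n + 1) ≃g cube (n + 1)) → Prop}
    (h1 : P (RelIso.refl _)) (hmul : ∀ g h, P g → P h → P (h.trans g))
    (hswap : ∀ i j d, P (moveCoord i j d)) (g : cube (n + 1) ≃g cube (n + 1)) : P g := by
  have hperm : ∀ p : Equiv.Perm (Fin (n + 1)), P (signedPerm p fun _ => false) := by
    intro p
    have hp : p ∈ Submonoid.closure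
        (Set.range fun i : Fin n => Equiv.swap i.castSucc i.succ) := by
      rw [Equiv.Perm.mclosure_swap_castSucc_succ]; trivial
    induction hp using Submonoid.closure_induction with
    | one =>
      convert h1 using 1
      ext t k
      simp [signedPerm_apply]
    | mul p q _ _ hp hq =>
      convert hmul _ _ hq hp using 1
      ext t k
      simp [signedPerm_apply]
    | mem p hp =>
      obtain ⟨k, rfl⟩ := hp
      convert hswap k.succ k.castSucc false using 1
      ext t l
      rw [signedPerm_apply, moveCoord_apply, Bool.xor_false, Bool.xor_false]
      rcases Fin.eq_self_or_eq_succAbove k.succ l with rfl | ⟨l, rfl⟩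
      · simp
      · rw [Fin.insertNth_apply_succAbove, Fin.removeNth]
        congr 1
        rcases lt_trichotomy l k with h | rfl | h
        · have h1 : l.castSucc < k.castSucc := Fin.castSucc_lt_castSucc_iff.2 h
          rw [Fin.succAbove_of_castSucc_lt _ _ (h1.trans Fin.castSucc_lt_succ),
            Fin.succAbove_of_castSucc_lt _ _ h1,
            Equiv.swap_apply_of_ne_of_ne h1.ne (h1.trans Fin.castSucc_lt_succ).ne]
        · simp
        · have h1 : k.succ < l.succ := Fin.succ_lt_succ_iff.2 h
          rw [Fin.succAbove_of_lt_succ _ _ h1,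
            Fin.succAbove_of_lt_succ _ _ (Fin.castSucc_lt_succ.trans h1),
            Equiv.swap_apply_of_ne_of_ne (Fin.castSucc_lt_succ.trans h1).ne' h1.ne']
  have hrefl : ∀ s : Finset (Fin (n + 1)), P (signedPerm 1 fun k => decide (k ∈ s)) := by
    intro s
    induction s using Finset.induction_on with
    | empty =>
      convert h1 using 1
      ext t k
      simp [signedPerm_apply]
    | insert i s hi ih =>
      convert hmul _ _ (hswap i i true) ih using 1
      ext t k
      change _ = (moveCoord i i true) (signedPerm 1 (fun k => decide (k ∈ s)) t) k
      rw [signedPerm_apply, moveCoord_apply]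
      rcases Fin.eq_self_or_eq_succAbove i k with rfl | ⟨k, rfl⟩
      · simp [signedPerm_apply, hi]
      · rw [Fin.insertNth_apply_succAbove, Fin.removeNth]
        refine Eq.trans ?_ (signedPerm_apply 1 (fun k => decide (k ∈ s)) t (i.succAbove k)).symm
        simp [Fin.succAbove_ne]
  obtain ⟨p, c, hp⟩ := exists_perm g
  convert hmul _ _ (hrefl (Finset.univ.filter fun k => c k = true)) (hperm p) using 1
  ext t k
  rw [hp]
  change _ = signedPerm 1 (fun k => decide (k ∈ Finset.univ.filter fun k => c k = true))
    (signedPerm p (fun _ => false) t) k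
  simp [signedPerm_apply]

theorem edgeClass_comp {n : ℕ} (g : cube n ≃g cube n) (σ : SingularCube G n) :
    edgeClass (σ.comp g) = (linearPart g).det • edgeClass σ := by
  have hrefl : ∀ σ : SingularCube G n, edgeClass (σ.comp (RelIso.refl _)) =
      (linearPart (RelIso.refl (cube n).Adj)).det • edgeClass σ := fun σ => by
    have : (linearPart (RelIso.refl (cube n).Adj)).det = 1 := det_linearPart_id
    rw [this, one_smul]
    rfl
  revert σ
  -- `moveCoord` needs a coordinate; `I^0` has only the identity.
  obtain _ | n := n
  · rwa [show g = RelIso.refl _ from RelIso.ext fun t => Subsingleton.elim _ _]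
  induction g using cubeIso_induction with
  | h1 => exact hrefl
  | hmul g h hg hh =>
    intro σ
    have : (linearPart (h.trans g)).det = _ := det_linearPart_comp g h
    rw [this, mul_smul, ← hg, ← hh]
    rfl
  | hswap i j d => exact fun σ => edgeClass_comp_moveCoord σ i j d

/-! ### Automorphisms that move every vertex by at most one edge -/

/-- An automorphism of the cube that moves every vertex by at most one edge either preserves the
orientation or is the reflection in one coordinate. -/
theorem det_eq_one_or_reflection {n : ℕ} (g : cube n ≃g cube n)
    (hg : ∀ t, hammingDist t (g t) ≤ 1) :
    (linearPart g).det = 1 ∨ ∃ k, ∀ t, g t = Function.update t k (!t k) := by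
  obtain ⟨p, c, hp⟩ := exists_perm g
  have hd : ∀ (t : Fin n → Bool) (k m : Fin n), t k ≠ (t (p k) ^^ c k) → t m ≠ (t (p m) ^^ c m) →
      k = m := by
    intro t k m hk hm
    rw [← hp] at hk hm
    exact Finset.card_le_one.1 (hg t) k (by simpa using hk) m (by simpa using hm)
  by_cases hp1 : p = 1
  · subst hp1
    by_cases hc : ∀ k, c k = false
    · left
      rw [det_linearPart hp]
      simp [hc, sg]
    · right
      push Not at hc
      obtain ⟨k, hk⟩ := hc
      refine ⟨k, fun t => funext fun m => ?_⟩
      rw [hp, Equiv.Perm.one_apply]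
      by_cases hm : m = k
      · subst hm
        simp [(Bool.not_eq_false _).mp hk]
      · rw [Function.update_of_ne hm]
        have : c m = false := by
          by_contra h
          exact hm (hd t m k (by simp [(Bool.not_eq_false _).mp h])
            (by simp [(Bool.not_eq_false _).mp hk]))
        simp [this]
  · left
    obtain ⟨k, hk⟩ : ∃ k, p k ≠ k := by
      by_contra! h
      exact hp1 (Equiv.ext h)
    obtain ⟨t, ht⟩ : ∃ t : Fin n → Bool, t k ≠ (t (p k) ^^ c k) :=
      ⟨Function.update (fun _ => false) (p k) (!c k), by simp [Function.update_of_ne hk.symm]⟩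
    -- Coordinate `k` keeps changing when `t` is altered outside `k` and `p k`. This freedom can
    -- make another moved coordinate change as well, which `hd` forbids.
    have hupd : ∀ x y, x ≠ k → x ≠ p k →
        Function.update t x y k ≠ (Function.update t x y (p k) ^^ c k) := by
      intro x y h1 h2
      rwa [Function.update_of_ne h1.symm, Function.update_of_ne h2.symm]
    have hmoved : ∀ m, m ≠ k → p m ≠ m → m = p k ∧ p m = k := by
      intro m hm hpm
      by_contra hcon
      by_cases hmk : m = p k
      · have h1 : p m ≠ k := fun h => hcon ⟨hmk, h⟩
        have h2 : p m ≠ p k := fun h => hm (p.injective h)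
        refine hm (hd (Function.update t (p m) (!(t m ^^ c m))) k m (hupd _ _ h1 h2) ?_).symm
        rw [Function.update_self, Function.update_of_ne hpm.symm]
        simp
      · refine hm (hd (Function.update t m (!(t (p m) ^^ c m))) k m (hupd _ _ hm hmk) ?_).symm
        rw [Function.update_self, Function.update_of_ne hpm]
        simp
    have hppk : p (p k) = k := (hmoved (p k) hk fun h => hk (p.injective h)).2
    have hswap : p = Equiv.swap k (p k) := by
      ext1 m
      by_cases h1 : m = k
      · subst h1; rw [Equiv.swap_apply_left]
      by_cases h2 : m = p k
      · subst h2; rw [Equiv.swap_apply_right, hppk]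
      rw [Equiv.swap_apply_of_ne_of_ne h1 h2]
      by_contra h
      exact h2 (hmoved m h1 h).1
    have hc : ∀ m, m ≠ k → m ≠ p k → c m = false := by
      intro m h1 h2
      by_contra h
      refine h1 (hd t k m ht ?_).symm
      rw [hswap, Equiv.swap_apply_of_ne_of_ne h1 h2, (Bool.not_eq_false _).mp h]
      simp
    -- With equal reflections, `k` and `p k` would both change at `t`. So exactly one of the two is
    -- reflected, and this sign cancels that of the transposition: `g` is a quarter turn of a
    -- square.
    have hck : c k ≠ c (p k) := by
      intro h
      refine hk (hd t k (p k) ht ?_).symm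
      rw [hppk, ← h]
      intro e
      rw [e] at ht
      simp at ht
    rw [det_linearPart hp, Finset.prod_eq_mul k (p k) hk.symm
      (fun m _ hm => by rw [hc m hm.1 hm.2]; rfl) (by simp) (by simp)]
    have hsign : Equiv.Perm.sign p = -1 := by rw [hswap]; exact Equiv.Perm.sign_swap hk.symm
    rw [hsign]
    revert hck
    cases c k <;> cases c (p k) <;> simp [sg]

/-- An automorphism of the cube that identifies two facets as a translation does. -/
theorem eq_moveCoord {n : ℕ} {g : cube (n + 1) ≃g cube (n + 1)} {i j : Fin (n + 1)} {a b : Bool}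
    (h : ∀ s : Fin n → Bool, g (j.insertNth b s) = i.insertNth a s) :
    g = moveCoord i j (a ^^ b) := by
  obtain ⟨p, c, hp⟩ := exists_perm g
  have hi : p i = j := by
    by_contra hne
    obtain ⟨l, hl⟩ := Fin.exists_succAbove_eq hne
    have h1 : ∀ s : Fin n → Bool, (s l ^^ c i) = a := fun s => by
      have := congrFun (h s) i
      rwa [hp, Fin.insertNth_apply_same, ← hl, Fin.insertNth_apply_succAbove] at this
    have h2 := (h1 fun _ => false).trans (h1 fun _ => true).symm
    simp at h2
  have hc : c i = (a ^^ b) := by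
    have := congrFun (h fun _ => false) i
    rw [hp, hi, Fin.insertNth_apply_same, Fin.insertNth_apply_same] at this
    rw [← this]
    cases b <;> simp
  ext t k
  rw [hp, moveCoord_apply]
  rcases Fin.eq_self_or_eq_succAbove i k with rfl | ⟨l, rfl⟩
  · rw [hi, hc, Fin.insertNth_apply_same]
  · rw [Fin.insertNth_apply_succAbove, Fin.removeNth]
    obtain ⟨r, hr⟩ := Fin.exists_succAbove_eq
      (show p (i.succAbove l) ≠ j from fun e => Fin.succAbove_ne i l (p.injective (e.trans hi.symm)))
    have h1 : ∀ s : Fin n → Bool, (s r ^^ c (i.succAbove l)) = s l := fun s => by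
      have := congrFun (h s) (i.succAbove l)
      rwa [hp, ← hr, Fin.insertNth_apply_succAbove, Fin.insertNth_apply_succAbove] at this
    have hc0 : c (i.succAbove l) = false := by simpa using h1 fun _ => false
    have hrl : r = l := by
      by_contra hne
      have := h1 (Function.update (fun _ => false) r true)
      simp [hc0, Function.update_of_ne (Ne.symm hne)] at this
    rw [← hr, hc0, hrl, Bool.xor_false]

/-! ### Cellular chains of arbitrary singular cubes -/

open Classical in
/-- The cellular chain represented by a singular cube, which is zero if the cube is not
injective. -/
noncomputable def CharMaps.cubeChain (χ : CharMaps G) {n : ℕ} (σ : SingularCube G n) :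
    Cell G n →₀ ℤ :=
  if h : Function.Injective σ.toFun then χ.cellChain σ h else 0

theorem CharMaps.cubeChain_of_injective (χ : CharMaps G) {n : ℕ} {σ : SingularCube G n}
    (h : Function.Injective σ.toFun) : χ.cubeChain σ = χ.cellChain σ h := dif_pos h

theorem CharMaps.cubeChain_of_not_injective (χ : CharMaps G) {n : ℕ} {σ : SingularCube G n}
    (h : ¬ Function.Injective σ.toFun) : χ.cubeChain σ = 0 := dif_neg h

theorem CharMaps.cubeChain_comp (χ : CharMaps G) {n : ℕ} (σ : SingularCube G n)
    (g : cube n ≃g cube n) : χ.cubeChain (σ.comp g) = (linearPart g).det • χ.cubeChain σ := by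
  by_cases h : Function.Injective σ.toFun
  · rw [χ.cubeChain_of_injective h, χ.cubeChain_of_injective (SingularCube.comp_injective h g),
      χ.cellChain_comp]
  · rw [χ.cubeChain_of_not_injective h, χ.cubeChain_of_not_injective, smul_zero]
    intro h'
    exact h ((Function.Injective.of_comp_iff' _ g.bijective).1 h')

theorem CharMaps.cubeChain_chart (χ : CharMaps G) {n : ℕ} (Q : Cell G n) :
    χ.cubeChain (χ.chart Q) = Finsupp.single Q 1 := by
  have hQ : (χ.chart Q).cell (χ.chart_injective Q) = Q := Subtype.ext (χ.image_chart Q)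
  rw [χ.cubeChain_of_injective (χ.chart_injective Q), CharMaps.cellChain, hQ,
    χ.sign_eq _ _ (RelIso.refl _) (by rw [hQ]; rfl)]
  congr 1
  exact det_linearPart_id

theorem CharMaps.cubeChain_apply_eq_zero (χ : CharMaps G) {n : ℕ} {σ : SingularCube G n}
    {Q : Cell G n} (h : σ.image ≠ Q.1) : χ.cubeChain σ Q = 0 := by
  by_cases hσ : Function.Injective σ.toFun
  · rw [χ.cubeChain_of_injective hσ]
    exact Finsupp.single_eq_of_ne fun e => h (congrArg Subtype.val e).symm
  · rw [χ.cubeChain_of_not_injective hσ]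
    rfl

/-- Composed with an isomorphism `Q ≅ I^n`, the cube becomes a surjective self-map of a finite set.
-/
theorem SingularCube.injective_of_image_eq {n : ℕ} {σ : SingularCube G n} {Q : Cell G n}
    (h : σ.image = Q.1) : Function.Injective σ.toFun := by
  obtain ⟨e⟩ := Q.2
  have hr : Set.range σ.toFun = Q.1.verts := congrArg SimpleGraph.Subgraph.verts h
  have hsurj : Function.Surjective fun t => e.symm ⟨σ.toFun t, hr ▸ Set.mem_range_self t⟩ := by
    intro t
    obtain ⟨s, hs⟩ : (e t).1 ∈ Set.range σ.toFun := by rw [hr]; exact (e t).2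
    exact ⟨s, by simp [hs]⟩
  intro x y hxy
  exact Finite.injective_iff_surjective.2 hsurj (by simp only [hxy])

theorem CharMaps.exists_eq_comp (χ : CharMaps G) {n : ℕ} {σ τ : SingularCube G n} {Q : Cell G n}
    (hσ : σ.image = Q.1) (hτ : τ.image = Q.1) : ∃ g : cube n ≃g cube n, σ = τ.comp g := by
  obtain ⟨g, hg⟩ := χ.exists_eq_chart_comp σ (SingularCube.injective_of_image_eq hσ)
  obtain ⟨f, hf⟩ := χ.exists_eq_chart_comp τ (SingularCube.injective_of_image_eq hτ)
  have e1 : σ.cell (SingularCube.injective_of_image_eq hσ) = Q := Subtype.ext hσ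
  have e2 : τ.cell (SingularCube.injective_of_image_eq hτ) = Q := Subtype.ext hτ
  rw [e1] at hg
  rw [e2] at hf
  refine ⟨g.trans f.symm, ?_⟩
  rw [hg, hf]
  ext t
  exact congrArg (χ.chart Q).toFun (f.apply_symm_apply (g t)).symm

/-! ### Boundaries of noninjective cubes in cellular chains -/

theorem SingularCube.face_apply {n : ℕ} (τ : SingularCube G (n + 1)) (i : Fin (n + 1)) (a : Bool)
    (t : Fin n → Bool) : (τ.face i a).toFun t = τ.toFun (i.insertNth a t) := rfl

/-- If two faces of a cube in different directions have the same cell as image, then the boundary of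
the cube represents the zero cellular chain. -/
theorem CharMaps.sum_cubeChain_faces_of_directions (χ : CharMaps G) {n : ℕ} {Q : Cell G (n + 1)}
    (τ : SingularCube G (n + 2)) (i : Fin (n + 2)) (j : Fin (n + 1)) (a b : Bool)
    (hi : (τ.face i a).image = Q.1) (hj : (τ.face (i.succAbove j) b).image = Q.1) :
    ∑ l : Fin (n + 2), (-1 : ℤ) ^ ((l : ℕ) + 1) •
      (χ.cubeChain (τ.face l false) - χ.cubeChain (τ.face l true)) = 0 := by
  obtain ⟨g, hg⟩ := χ.exists_eq_comp hi hj
  -- The two faces agree on the codimension two face where they meet, so injectivity determines `g`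
  -- on a facet.
  have hg' : g = moveCoord (j.predAbove i) j (a ^^ b) := by
    refine eq_moveCoord fun s => SingularCube.injective_of_image_eq hj ?_
    have h1 := congrArg (fun σ => SingularCube.toFun σ s) (face_face i j a b τ)
    have h2 := congrArg (fun σ => SingularCube.toFun σ (j.insertNth b s)) hg
    exact h2.symm.trans h1
  subst hg'
  -- Comparing the two faces on the facets away from their intersection identifies two diagonally
  -- opposite codimension two faces of `τ`. Hence the two remaining faces in these directions differ
  -- by the same automorphism (`hopp`).
  have hmeet : ∀ s : Fin n → Bool, τ.toFun (i.insertNth a (j.insertNth (!b) s)) =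
      τ.toFun (i.insertNth (!a) (j.insertNth b s)) := by
    intro s
    have h2 := congrArg (fun σ => SingularCube.toFun σ (j.insertNth (!b) s)) hg
    simp only [SingularCube.face_apply, SingularCube.comp, moveCoord_apply,
      Fin.insertNth_apply_same, Fin.removeNth_insertNth] at h2
    rw [h2, insertNth_insertNth i j (!a) b]
    congr 3
    cases a <;> cases b <;> rfl
  have hopp : τ.face i (!a) =
      (τ.face (i.succAbove j) (!b)).comp (moveCoord (j.predAbove i) j (a ^^ b)) := by
    ext t
    obtain ⟨y, s, rfl⟩ : ∃ y s, t = j.insertNth y s :=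
      ⟨_, _, (j.insertNth_self_removeNth t).symm⟩
    simp only [SingularCube.face_apply, SingularCube.comp, moveCoord_apply,
      Fin.insertNth_apply_same, Fin.removeNth_insertNth]
    rw [← insertNth_insertNth i j]
    by_cases hy : y = b
    · subst hy
      rw [← hmeet]
      congr 3
      cases a <;> cases y <;> rfl
    · have : y = !b := by cases y <;> cases b <;> simp_all
      subst this
      congr 2
      cases a <;> cases b <;> rfl
  rw [sum_faces_two_directions (fun l c => χ.cubeChain (τ.face l c)) i j]
  · have h1 := χ.cubeChain_comp (τ.face (i.succAbove j) b) (moveCoord (j.predAbove i) j (a ^^ b))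
    rw [← hg, det_moveCoord] at h1
    have h2 := χ.cubeChain_comp (τ.face (i.succAbove j) (!b)) (moveCoord (j.predAbove i) j (a ^^ b))
    rw [← hopp, det_moveCoord] at h2
    rw [sub_eq_zero.2, smul_zero]
    cases a <;> cases b <;>
      simp only [Bool.not_false, Bool.not_true, sg, Bool.xor_false, Bool.xor_true, if_true,
        if_false, mul_one, mul_neg, Bool.false_eq_true, neg_smul] at h1 h2 ⊢ <;>
      rw [h1, h2, smul_sub] <;> abel
  -- A face in any third direction contains two points identified by `hmeet`.
  · intro l c hl1 hl2
    refine χ.cubeChain_of_not_injective ?_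
    obtain ⟨k, rfl⟩ := Fin.exists_succAbove_eq hl1
    obtain ⟨r, rfl⟩ := Fin.exists_succAbove_eq (show k ≠ j from fun e => hl2 (by rw [e]))
    refine SingularCube.not_injective_face τ ?_ ?_ ?_ (hmeet fun _ => c)
    · simp
    · simp
    · intro e
      have := congrFun e i
      simp at this

theorem CharMaps.sum_cubeChain_faces_eq_zero (χ : CharMaps G) {n : ℕ} (hG : IsQuasimonophobic G n)
    (τ : SingularCube G (n + 1)) (hτ : ¬ Function.Injective τ.toFun) :
    ∑ l : Fin (n + 1), (-1 : ℤ) ^ ((l : ℕ) + 1) •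
      (χ.cubeChain (τ.face l false) - χ.cubeChain (τ.face l true)) = 0 := by
  ext Q
  by_cases hdir : ∃ i a j b, i ≠ j ∧ (τ.face i a).image = Q.1 ∧ (τ.face j b).image = Q.1
  · obtain ⟨i, a, j, b, hij, hi, hj⟩ := hdir
    obtain ⟨k, rfl⟩ := Fin.exists_succAbove_eq hij.symm
    obtain ⟨m, rfl⟩ : ∃ m, n = m + 1 := ⟨n - 1, by have := k.pos; omega⟩
    rw [χ.sum_cubeChain_faces_of_directions τ i k a b hi hj]
  push Not at hdir
  simp only [Finsupp.coe_finsetSum, Finset.sum_apply, Finsupp.coe_smul, Pi.smul_apply,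
    Finsupp.coe_sub, Pi.sub_apply, Finsupp.coe_zero, Pi.zero_apply]
  by_cases hex : ∃ i a, (τ.face i a).image = Q.1
  swap
  · push Not at hex
    refine Finset.sum_eq_zero fun i _ => ?_
    rw [χ.cubeChain_apply_eq_zero (hex i _), χ.cubeChain_apply_eq_zero (hex i _), sub_zero,
      smul_zero]
  obtain ⟨i, a, hia⟩ := hex
  obtain ⟨hind, hface⟩ := hG Q.1 Q.2
  obtain ⟨j, b, hjb, hj⟩ := hface τ hτ i a hia
  -- The second face provided by quasimonophobicity lies in the same direction, so it is the
  -- opposite face.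
  have hij : i = j := by
    by_contra h
    exact hdir i a j b h hia hj
  subst hij
  have hboth : ∀ c, (τ.face i c).image = Q.1 := by
    intro c
    by_cases hc : c = a
    · rw [hc, hia]
    · have : c = b := by
        have : b ≠ a := fun e => hjb (by rw [e])
        cases a <;> cases b <;> cases c <;> simp_all
      rw [this, hj]
  rw [Finset.sum_eq_single i _ (by simp)]
  swap
  · intro l _ hl
    rw [χ.cubeChain_apply_eq_zero (hdir i a l false hl.symm hia),
      χ.cubeChain_apply_eq_zero (hdir i a l true hl.symm hia), sub_zero, smul_zero]
  obtain ⟨g, hg⟩ := χ.exists_eq_comp (hboth true) (hboth false)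
  have hinj := SingularCube.injective_of_image_eq (hboth false)
  -- Edges in direction `i` join corresponding vertices of the two faces. As `Q` is induced, such an
  -- edge of `G` is an edge of `Q`, hence the image of an edge of the cube.
  have hdist : ∀ t, hammingDist t (g t) ≤ 1 := by
    intro t
    have h1 : (τ.face i true).toFun t = (τ.face i false).toFun (g t) :=
      congrArg (fun σ => SingularCube.toFun σ t) hg
    have h2 := τ.map_adj (i.insertNth false t) (i.insertNth true t) (by
      change hammingDist _ _ = 1
      rw [hammingDist_insertNth]
      simp)
    change G.Adj ((τ.face i false).toFun t) ((τ.face i true).toFun t) ∨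
      (τ.face i false).toFun t = (τ.face i true).toFun t at h2
    rw [h1] at h2
    rcases h2 with h2 | h2
    · have hv : ∀ s, (τ.face i false).toFun s ∈ Q.1.verts := fun s => by
        rw [← hboth false]
        exact ⟨s, rfl⟩
      have h3 := hind (hv t) (hv (g t)) h2
      rw [← hboth false] at h3
      obtain ⟨-, x, y, hxy, hx, hy⟩ := h3
      have h4 : hammingDist x y = 1 := hxy
      rw [hinj hx, hinj hy] at h4
      exact h4.le
    · rw [← hinj h2, hammingDist_self]
      exact Nat.zero_le _
  rcases det_eq_one_or_reflection g hdist with hdet | ⟨k, hk⟩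
  · rw [hg, χ.cubeChain_comp, hdet, one_smul, sub_self, smul_zero]
  -- If the faces differ by the reflection in `k`, then on the face with coordinate `i.succAbove k`
  -- equal to `0` the `i`-th coordinate plays the role of the `k`-th one. That face therefore also
  -- has image `Q`.
  · exfalso
    obtain ⟨m, rfl⟩ : ∃ m, n = m + 1 := ⟨n - 1, by have := k.pos; omega⟩
    refine hdir i a (i.succAbove k) false (Fin.succAbove_ne i k).symm hia ?_
    rw [← hboth false,
      ← SingularCube.image_comp (τ.face i false) (moveCoord k (k.predAbove i) false)]
    congr 1
    ext t
    obtain ⟨x, s, rfl⟩ : ∃ x s, t = (k.predAbove i).insertNth x s :=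
      ⟨_, _, ((k.predAbove i).insertNth_self_removeNth t).symm⟩
    simp only [SingularCube.face_apply, SingularCube.comp, moveCoord_apply,
      Fin.insertNth_apply_same, Fin.removeNth_insertNth, Bool.xor_false]
    rw [← insertNth_insertNth]
    cases x
    · rfl
    · have h1 := congrArg (fun σ => SingularCube.toFun σ (k.insertNth false s)) hg
      refine h1.trans ?_
      simp only [SingularCube.comp, hk, SingularCube.face_apply, Fin.insertNth_apply_same,
        Fin.update_insertNth]
      rfl

/-! ### Comparison of the complexes -/

/-- Singular cubes of top degree as cellular chains. -/
theorem CharMaps.exists_grOf_eq_cubeChain (χ : CharMaps G) (n : ℕ) :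
    ∃ ψ : Gr G n n →ₗ[ℤ] (Cell G n →₀ ℤ), ∀ σ, ψ (grOf σ) = χ.cubeChain σ := by
  let ψ₁ : Chains G n →ₗ[ℤ] (Cell G n →₀ ℤ) :=
    (degenerate G n).liftQ (Finsupp.linearCombination ℤ χ.cubeChain) (by
      rw [degenerate, Submodule.span_le]
      rintro _ ⟨σ, hσ, rfl⟩
      change Finsupp.linearCombination ℤ χ.cubeChain (Finsupp.single σ 1) = 0
      rw [Finsupp.linearCombination_single, χ.cubeChain_of_not_injective
        (IsDegenerate.not_injective hσ), smul_zero])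
  have hψ₁ : ∀ σ, ψ₁ (chainOf σ) = χ.cubeChain σ := fun σ => by
    change Finsupp.linearCombination ℤ χ.cubeChain (Finsupp.single σ 1) = _
    rw [Finsupp.linearCombination_single, one_smul]
  have hψ₂ : fil G n n ≤ LinearMap.ker ψ₁ := by
    rw [fil, Submodule.span_le]
    rintro _ ⟨σ, hσ, rfl⟩
    exact (hψ₁ σ).trans (χ.cubeChain_of_not_injective ((degree_lt_iff σ).1 hσ))
  exact ⟨Submodule.liftQ _ (ψ₁.comp (fil G (n + 1) n).subtype) fun x hx => hψ₂ hx, hψ₁⟩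

theorem CharMaps.map_bdGr_eq_zero (χ : CharMaps G) {n : ℕ} (hG : IsQuasimonophobic G n)
    (ψ : Gr G n n →ₗ[ℤ] (Cell G n →₀ ℤ)) (hψ : ∀ σ, ψ (grOf σ) = χ.cubeChain σ)
    (y : Gr G n (n + 1)) : ψ (bdGr G n n y) = 0 := by
  obtain ⟨y, rfl⟩ := Submodule.mkQ_surjective _ y
  induction y using fil_induction with
  | h0 => simp
  | hadd x y hx hy => rw [map_add, map_add, map_add, hx, hy, add_zero]
  | hsmul m x hx => rw [map_smul, map_smul, map_smul, hx, smul_zero]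
  | hof σ hσ =>
    refine (congrArg ψ (mk_sum_faces σ (bdFil G (n + 1) n ⟨chainOf σ, _⟩) rfl)).trans ?_
    rw [map_sum]
    simp only [map_smul, map_sub, hψ]
    exact χ.sum_cubeChain_faces_eq_zero hG σ ((degree_lt_iff σ).1 hσ)

/-- The sign in `cellChain` is the determinant by which `edgeClass_comp` changes the class of the
chart. -/
theorem CharMaps.linearCombination_edgeClass_cellChain (χ : CharMaps G) {n : ℕ}
    (σ : SingularCube G n) (h : Function.Injective σ.toFun) :
    Finsupp.linearCombination ℤ (fun Q : Cell G n => edgeClass (χ.chart Q)) (χ.cellChain σ h) =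
      edgeClass σ := by
  obtain ⟨g, hg⟩ := χ.exists_eq_chart_comp σ h
  rw [CharMaps.cellChain, Finsupp.linearCombination_single, χ.sign_eq σ h g hg]
  refine (int_smul_eq_zsmul _ _ _).trans ((edgeClass_comp g _).symm.trans ?_)
  rw [← hg]

theorem CharMaps.linearCombination_edgeClass_surjective (χ : CharMaps G) (n : ℕ) :
    Function.Surjective
      (Finsupp.linearCombination ℤ fun Q : Cell G n => edgeClass (χ.chart Q)) := by
  rw [← LinearMap.range_eq_top, eq_top_iff, ← span_edgeClass, Submodule.span_le]
  rintro _ ⟨σ, rfl⟩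
  by_cases h : Function.Injective σ.toFun
  · exact ⟨_, χ.linearCombination_edgeClass_cellChain σ h⟩
  · rw [edgeClass_eq_zero h]
    exact Submodule.zero_mem _

/-- A cellular chain in the kernel becomes a boundary in `C^{[n]}_n`. The map `ψ` kills boundaries
but returns each chart to its cell, so the chain is zero. -/
theorem CharMaps.linearCombination_edgeClass_injective (χ : CharMaps G) {n : ℕ}
    (hG : IsQuasimonophobic G n) :
    Function.Injective
      (Finsupp.linearCombination ℤ fun Q : Cell G n => edgeClass (χ.chart Q)) := by
  rw [injective_iff_map_eq_zero]
  intro x hx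
  have h1 : homologyClass G n (Finsupp.linearCombination ℤ (fun Q => grOf (χ.chart Q)) x) = 0 :=
    (Finsupp.apply_linearCombination ℤ (homologyClass G n) (fun Q => grOf (χ.chart Q)) x).trans hx
  obtain ⟨y, hy⟩ := exists_of_homologyClass_eq_zero n _ h1
  obtain ⟨ψ, hψ⟩ := χ.exists_grOf_eq_cubeChain n
  have h2 := χ.map_bdGr_eq_zero hG ψ hψ y
  rw [hy, Finsupp.apply_linearCombination] at h2
  have h3 : (ψ ∘ fun Q : Cell G n => grOf (χ.chart Q)) = fun Q => Finsupp.single Q 1 :=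
    funext fun Q => (hψ _).trans (χ.cubeChain_chart Q)
  rw [h3] at h2
  simpa [Finsupp.linearCombination_apply] using h2

/-- The chain map from the cellular complex to the edge complex. -/
noncomputable def cellToEdgeHom (χ : CharMaps G) : cellComplex χ ⟶ edgeComplex G :=
  ChainComplex.ofHom (fun n => cellToEdge χ n) (fun n => by
    refine ModuleCat.hom_ext (Finsupp.lhom_ext' fun Q => LinearMap.ext_ring ?_)
    simp only [cellComplex, edgeComplex, ChainComplex.of_d]
    have h1 := edgeD_edgeClass n (χ.chart Q)
    have h2 : Finsupp.linearCombination ℤ (fun Q : Cell G n => edgeClass (χ.chart Q))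
        (χ.bdChain (χ.chart Q) (χ.chart_injective Q)) = _ := map_sum _ _ _
    simp only [map_zsmul, map_sub, χ.linearCombination_edgeClass_cellChain] at h2
    have h3 : Finsupp.linearCombination ℤ (fun Q : Cell G (n + 1) => edgeClass (χ.chart Q))
        (Finsupp.single Q 1) = edgeClass (χ.chart Q) := by
      rw [Finsupp.linearCombination_single]
      exact (int_smul_eq_zsmul _ 1 _).trans (one_zsmul _)
    have h4 : χ.cellBd n (Finsupp.single Q 1) = χ.bdChain (χ.chart Q) (χ.chart_injective Q) := by
      rw [CharMaps.cellBd, Finsupp.linearCombination_single, one_smul]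
    exact (congrArg (edgeD G n).hom h3).trans (h1.trans (h2.symm.trans (congrArg _ h4.symm))))

/-! ### From chain groups to homology -/

theorem homologyMap_injective_of_f {K L : ChainComplex (ModuleCat.{u} ℤ) ℕ} (φ : K ⟶ L) (n : ℕ)
    (hs : Epi (φ.f (n + 1))) (hi : Mono (φ.f n)) :
    Function.Injective (HomologicalComplex.homologyMap φ n) := by
  rw [injective_iff_map_eq_zero]
  intro x hx
  obtain ⟨z, rfl⟩ := (ModuleCat.epi_iff_surjective (K.homologyπ n)).1 inferInstance x
  have h1 := ConcreteCategory.congr_hom (HomologicalComplex.homologyπ_naturality φ n) z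
  simp only [ConcreteCategory.comp_apply] at h1
  rw [hx] at h1
  -- The image cycle bounds in `L`; a bounding chain lifts to `K`, and injectivity on cycles shows
  -- that the lift bounds `z`.
  obtain ⟨y, hy⟩ := exists_toCycles_of_homologyπ_eq_zero n _ h1.symm
  obtain ⟨y, rfl⟩ := (ModuleCat.epi_iff_surjective (φ.f (n + 1))).1 hs y
  have hmono : Function.Injective (HomologicalComplex.cyclesMap φ n) := by
    refine (ModuleCat.mono_iff_injective _).1 ?_
    have : Mono (HomologicalComplex.cyclesMap φ n ≫ L.iCycles n) := by
      rw [HomologicalComplex.cyclesMap_i]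
      exact mono_comp _ _
    exact mono_of_mono _ (L.iCycles n)
  have h2 : φ.f (n + 1) ≫ L.toCycles (n + 1) n =
      K.toCycles (n + 1) n ≫ HomologicalComplex.cyclesMap φ n := by
    rw [← cancel_mono (L.iCycles n)]
    simp
  have h3 := ConcreteCategory.congr_hom h2 y
  simp only [ConcreteCategory.comp_apply] at h3
  rw [hy] at h3
  rw [hmono h3, ← ConcreteCategory.comp_apply, HomologicalComplex.toCycles_comp_homologyπ]
  rfl

theorem homologyMap_surjective_of_f {K L : ChainComplex (ModuleCat.{u} ℤ) ℕ} (φ : K ⟶ L) (n : ℕ)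
    (hs : Epi (φ.f n)) (hi : ∀ m, m + 1 = n → Mono (φ.f m)) :
    Function.Surjective (HomologicalComplex.homologyMap φ n) := by
  intro x
  obtain ⟨z, rfl⟩ := (ModuleCat.epi_iff_surjective (L.homologyπ n)).1 inferInstance x
  obtain ⟨y, hy⟩ := (ModuleCat.epi_iff_surjective (φ.f n)).1 hs (L.iCycles n z)
  -- The lift `y` of a cycle is a cycle: its boundary maps to zero under an injective map, or `n =
  -- 0` and the differential vanishes.
  have hdy : K.d n ((ComplexShape.down ℕ).next n) y = 0 := by
    by_cases hn : ∃ m, m + 1 = n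
    · obtain ⟨m, rfl⟩ := hn
      rw [ChainComplex.next_nat_succ]
      refine (ModuleCat.mono_iff_injective _).1 (hi m rfl) ?_
      rw [map_zero, ← ConcreteCategory.comp_apply, ← HomologicalComplex.Hom.comm,
        ConcreteCategory.comp_apply, hy, ← ConcreteCategory.comp_apply,
        HomologicalComplex.iCycles_d]
      rfl
    · rw [K.shape n _ fun h => hn ⟨_, h⟩]
      rfl
  have hex : (ShortComplex.mk _ _ (K.iCycles_d n ((ComplexShape.down ℕ).next n))).Exact :=
    ShortComplex.exact_of_f_is_kernel _ (K.cyclesIsKernel n _ rfl)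
  rw [ShortComplex.moduleCat_exact_iff] at hex
  obtain ⟨c, hc⟩ := hex y hdy
  refine ⟨K.homologyπ n c, ?_⟩
  rw [← ConcreteCategory.comp_apply, HomologicalComplex.homologyπ_naturality,
    ConcreteCategory.comp_apply]
  congr 1
  refine (ModuleCat.mono_iff_injective (L.iCycles n)).1 inferInstance ?_
  rw [← ConcreteCategory.comp_apply, HomologicalComplex.cyclesMap_i, ConcreteCategory.comp_apply,
    ← hy]
  exact congrArg _ hc

end DiscreteCubical

theorem mainTheorem4 {V : Type u} (G : SimpleGraph V) (χ : DiscreteCubical.CharMaps G) :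
    ∃ φ : DiscreteCubical.cellComplex χ ⟶ DiscreteCubical.edgeComplex G,
      (∀ n : ℕ, φ.f n = DiscreteCubical.cellToEdge χ n) ∧
      ∀ n : ℕ, DiscreteCubical.IsQuasimonophobic G n →
        Function.Injective (HomologicalComplex.homologyMap φ n) ∧
        ((∀ m : ℕ, m + 1 = n → DiscreteCubical.IsQuasimonophobic G m) →
          Function.Bijective (HomologicalComplex.homologyMap φ n)) := by
  have hepi : ∀ n, CategoryTheory.Epi ((DiscreteCubical.cellToEdgeHom χ).f n) := fun n =>
    (ModuleCat.epi_iff_surjective _).2 (χ.linearCombination_edgeClass_surjective n)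
  have hmono : ∀ n, DiscreteCubical.IsQuasimonophobic G n →
      CategoryTheory.Mono ((DiscreteCubical.cellToEdgeHom χ).f n) := fun n hG =>
    (ModuleCat.mono_iff_injective _).2 (χ.linearCombination_edgeClass_injective hG)
  refine ⟨DiscreteCubical.cellToEdgeHom χ, fun n => rfl, fun n hG => ?_⟩
  have hinj := DiscreteCubical.homologyMap_injective_of_f (DiscreteCubical.cellToEdgeHom χ) n
    (hepi _) (hmono n hG)
  exact ⟨hinj, fun hG' => ⟨hinj, DiscreteCubical.homologyMap_surjective_of_f
    (DiscreteCubical.cellToEdgeHom χ) n (hepi n) fun m hm => hmono m (hG' m hm)⟩⟩
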